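/- **Setting.** Let $\mathfrak X_0$ be an arithmetic scheme, i.e. an integral normal scheme which is flat and of finite type over $\operatorname{Spec}\mathbb Z$, with function field $K_0$. Let $K/K_0$ be a (possibly infinite) Galois extension which is radicially closed: every polynomial $T^N-a$ with $a\in K$, $N\ge 1$, decomposes into linear factors over $K$. Let $G=\operatorname{Gal}(K/K_0)$, let $\pi:\mathfrak X\to\mathfrak X_0$ be the normalization of $\mathfrak X_0$ in $K$, and let $\mathbb C$ be an algebraically closed field of characteristic zero (not necessarily the complex numbers). Let $\dot{\mathfrak X}(\mathbb C)$ be the set of pairs $(\mathfrak x,\overline P^\times)$ where $\mathfrak x\in\mathfrak X$ is a point and $\overline P^\times:\kappa(\mathfrak x)^\times\to\mathbb C^\times$ is a group homomorphism, subject to the only condition that the torsion subgroup $(\ker\overline P^\times)_{\mathrm{tors}}$ is finite. The group $G$ acts on it from the right by $(\mathfrak x,\overline P^\times)^\sigma=(\sigma^{-1}(\mathfrak x),\overline P^\times\circ\sigma)$, and the multiplicative monoid $\mathcal N$ of positive integers acts by the $G$-equivariant maps $F_\nu(\mathfrak x,\overline P^\times)=(\mathfrak x,\overline P^\times\circ(\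 )^\nu)$. Let $\dot{\mathfrak X}_0(\mathbb C)=\dot{\mathfrak X}(\mathbb C)/G$ with the induced action of $\mathcal N$, and let $\check{\mathfrak X}_0(\mathbb C)=\operatorname{colim}_{\mathcal N}\dot{\mathfrak X}_0(\mathbb C)$ be the colimit over $\mathcal N$ ordered by divisibility, with transition maps $F_{\nu'/\nu}$ for $\nu\mid\nu'$. On $\check{\mathfrak X}_0(\mathbb C)$ the maps $F_\nu$ become bijective, so the group $\mathbb Q^{>0}$ acts, $q=\nu/\nu'$ acting by $F_\nu\circ F_{\nu'}^{-1}$. Let $\mathrm{pr}_0:\check{\mathfrak X}_0(\mathbb C)\to\mathfrak X_0$ be the $\mathbb Q^{>0}$-invariant projection induced by $(\mathfrak x,\overline P^\times)\mapsto\pi(\mathfrak x)$. For $P_0\in\check{\mathfrak X}_0(\mathbb C)$ write $(\mathbb Q^{>0})_{P_0}$ for its stabilizer. **Theorem.** (a) Let $P_0\in\check{\mathfrak X}_0(\mathbb C)$ and $\mathfrak x_0=\mathrm{pr}_0(P_0)$. If $(\mathbb Q^{>0})_{P_0}\ne 1$, then the characteristic $p$ of $\kappa(\mathfrak x_0)$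 is positive and $(\mathbb Q^{>0})_{P_0}\subset N_{\mathfrak x_0}^{\mathbb Z}=\{N_{\mathfrak x_0}^n: n\in\mathbb Z\}$, where $N_{\mathfrak x_0}=|\kappa(\mathfrak x_0)\cap\overline{\mathbb F}_p|$ is the number of elements of $\kappa(\mathfrak x_0)$ that are algebraic over $\mathbb F_p$. (b) For every point $\mathfrak x_0\in\mathfrak X_0$ with $\operatorname{char}\kappa(\mathfrak x_0)>0$ there exists a point $P_0\in\check{\mathfrak X}_0(\mathbb C)$ with $\mathrm{pr}_0(P_0)=\mathfrak x_0$ and $(\mathbb Q^{>0})_{P_0}\ne 1$. -/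

import Mathlib

open CategoryTheory AlgebraicGeometry

universe u v

noncomputable section

namespace ArithDyn

/-! ### Arithmetic schemes and radicially closed fields -/

/-- An arithmetic scheme: an integral normal scheme, flat and of finite type over `Spec ℤ`
(`Spec (ULift ℤ)` is the terminal object of `Scheme.{u}`). -/
class IsArithmetic (X : Scheme.{u}) : Prop where
  integral : IsIntegral X
  normal : ∀ x : X, IsIntegrallyClosed (X.presheaf.stalk x)
  flat : Flat (specULiftZIsTerminal.from X)
  locallyOfFiniteType : LocallyOfFiniteType (specULiftZIsTerminal.from X)
  quasiCompact : QuasiCompact (specULiftZIsTerminal.from X)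

instance (priority := 100) (X : Scheme.{u}) [h : IsArithmetic X] : IsIntegral X := h.integral

/-- A field is radicially closed if all polynomials `T ^ N - a` decompose into linear factors. -/
def IsRadiciallyClosed (K : Type*) [Field K] : Prop :=
  ∀ (a : K) (N : ℕ), 0 < N → (Polynomial.X ^ N - Polynomial.C a).Splits

/-! ### Points with a multiplicative character -/

/-- The set of pairs `(x, χ)` where `x` is a point of the scheme `X` and `χ : κ(x)ˣ → Cˣ` is a
homomorphism whose kernel has finite torsion subgroup. -/
@[ext]
structure CharPoint (X : Scheme.{u}) (C : Type v) [Field C] where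
  pt : X
  char : (X.residueField pt)ˣ →* Cˣ
  finite_torsion : {y : (X.residueField pt)ˣ | y ∈ char.ker ∧ IsOfFinOrder y}.Finite

namespace CharPoint

variable {C : Type v} [Field C]

/-- Functoriality of `CharPoint`: a morphism `g : X ⟶ Y` sends `(x, χ)` to `(g x, χ ∘ g♯)` where
`g♯ : κ(g x)ˣ → κ(x)ˣ` is induced by `g`. -/
def map {X Y : Scheme.{u}} (g : X ⟶ Y) (P : CharPoint X C) : CharPoint Y C where
  pt := g P.pt
  char := P.char.comp (Units.map (g.residueFieldMap P.pt).hom.toMonoidHom)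
  finite_torsion := by
    refine (P.finite_torsion.preimage (f := Units.map (g.residueFieldMap P.pt).hom.toMonoidHom)
      (Set.injOn_of_injective
        (Units.map_injective (RingHom.injective (g.residueFieldMap P.pt).hom)))).subset ?_
    rintro y ⟨hy, hy'⟩
    exact ⟨hy, MonoidHom.isOfFinOrder _ hy'⟩

@[simp] lemma map_pt {X Y : Scheme.{u}} (g : X ⟶ Y) (P : CharPoint X C) :
    (P.map g).pt = g P.pt := rfl

lemma map_id {X : Scheme.{u}} (P : CharPoint X C) : P.map (𝟙 X) = P := by
  obtain ⟨x, χ, h⟩ := P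
  have e : (Scheme.Hom.residueFieldMap (𝟙 X) x) = 𝟙 (X.residueField x) :=
    Scheme.residueFieldMap_id x
  refine CharPoint.ext rfl (heq_of_eq (DFunLike.ext _ _ fun (y : (X.residueField x)ˣ) =>
    Units.ext ?_))
  change ((χ (Units.map (Scheme.Hom.residueFieldMap (𝟙 X) x).hom.toMonoidHom y) : Cˣ) : C) = χ y
  congr 2
  ext
  change (Scheme.Hom.residueFieldMap (𝟙 X) x).hom (y : X.residueField x) =
    (y : X.residueField x)
  rw [e]
  rfl

lemma map_comp {X Y Z : Scheme.{u}} (g : X ⟶ Y) (h : Y ⟶ Z) (P : CharPoint X C) :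
    P.map (g ≫ h) = (P.map g).map h := by
  obtain ⟨x, χ, hχ⟩ := P
  have e := Scheme.residueFieldMap_comp g h x
  refine CharPoint.ext rfl (heq_of_eq (DFunLike.ext _ _
    fun (y : (Z.residueField (h (g x)))ˣ) => Units.ext ?_))
  change ((χ (Units.map ((g ≫ h).residueFieldMap x).hom.toMonoidHom y) : Cˣ) : C) =
    χ (Units.map (g.residueFieldMap x).hom.toMonoidHom
      (Units.map (h.residueFieldMap (g x)).hom.toMonoidHom y))
  congr 2
  ext
  change ((g ≫ h).residueFieldMap x).hom (y : Z.residueField (h (g x))) =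
    (g.residueFieldMap x).hom ((h.residueFieldMap (g x)).hom (y : Z.residueField (h (g x))))
  rw [e]
  rfl

/-- The Frobenius map `F_ν (x, χ) = (x, χ ∘ ( )^ν)`. -/
def frob {X : Scheme.{u}} (ν : ℕ+) (P : CharPoint X C) : CharPoint X C where
  pt := P.pt
  char := P.char.comp (powMonoidHom (ν : ℕ))
  finite_torsion := by
    refine (P.finite_torsion.preimage' (f := fun y => y ^ (ν : ℕ)) fun b _ => ?_).subset ?_
    · refine Set.Finite.of_finite_image (f := fun y : (X.residueField P.pt)ˣ =>
        (y : X.residueField P.pt)) ?_ Units.val_injective.injOn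
      refine (Polynomial.nthRoots (ν : ℕ) (b : X.residueField P.pt)).finite_toSet.subset ?_
      rintro _ ⟨y, hy, rfl⟩
      have hy' : y ^ (ν : ℕ) = b := hy
      change (y : X.residueField P.pt) ∈ Polynomial.nthRoots (ν : ℕ) (b : X.residueField P.pt)
      rw [Polynomial.mem_nthRoots ν.pos, ← hy']
      simp
    · rintro y ⟨hy, hy'⟩
      exact ⟨hy, hy'.pow⟩

/-- The action of the multiplicative monoid of positive integers by the maps `F_ν`. -/
instance (X : Scheme.{u}) : MulAction ℕ+ (CharPoint X C) where
  smul := frob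
  one_smul P := by
    refine CharPoint.ext rfl (heq_of_eq ?_)
    ext y
    change ((P.char (y ^ ((1 : ℕ+) : ℕ)) : Cˣ) : C) = P.char y
    simp
  mul_smul ν ν' P := by
    refine CharPoint.ext rfl (heq_of_eq ?_)
    ext y
    change ((P.char (y ^ ((ν * ν' : ℕ+) : ℕ)) : Cˣ) : C) = P.char ((y ^ (ν : ℕ)) ^ (ν' : ℕ))
    rw [← pow_mul, PNat.mul_coe]

lemma smul_def {X : Scheme.{u}} (ν : ℕ+) (P : CharPoint X C) : ν • P = P.frob ν := rfl

lemma map_smul {X Y : Scheme.{u}} (g : X ⟶ Y) (ν : ℕ+) (P : CharPoint X C) :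
    (ν • P).map g = ν • P.map g := by
  refine CharPoint.ext rfl (heq_of_eq ?_)
  ext y
  change ((P.char (_ ^ (ν : ℕ)) : Cˣ) : C) = P.char (Units.map _ (y ^ (ν : ℕ)))
  rw [_root_.map_pow]
  rfl

end CharPoint

/-! ### The normalization `𝔛` of `𝔛₀` in `K`, with its Galois action -/

section Normalization

variable (X₀ : Scheme.{u}) [IsArithmetic X₀]
  (K : Type u) [Field K] [Algebra X₀.functionField K]

/-- The morphism `Spec K ⟶ 𝔛₀` over the generic point. -/
def specTo : Spec (.of K) ⟶ X₀ :=
  Spec.map (CommRingCat.ofHom (algebraMap X₀.functionField K)) ≫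
    X₀.fromSpecStalk (genericPoint X₀)

instance : IsLocallyNoetherian X₀ :=
  have : IsNoetherianRing (ULift.{u} ℤ) :=
    isNoetherianRing_of_ringEquiv ℤ ULift.ringEquiv.symm
  have := IsArithmetic.locallyOfFiniteType (X := X₀)
  LocallyOfFiniteType.isLocallyNoetherian (specULiftZIsTerminal.from X₀)

/-- The normalization `𝔛` of `𝔛₀` in `K`. -/
abbrev normalizationIn : Scheme.{u} := (specTo X₀ K).normalization

/-- The natural morphism `π : 𝔛 ⟶ 𝔛₀`. -/
abbrev normalizationMap : normalizationIn X₀ K ⟶ X₀ := (specTo X₀ K).fromNormalization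

variable {X₀ K}

/-- The morphism `Spec K ⟶ Spec K` over `𝔛₀` given by `σ ∈ Gal(K/K₀)`. -/
def specAut (σ : K ≃ₐ[X₀.functionField] K) : Spec (.of K) ⟶ Spec (.of K) :=
  Spec.map (CommRingCat.ofHom (σ : K →+* K))

lemma specAut_specTo (σ : K ≃ₐ[X₀.functionField] K) :
    specAut σ ≫ specTo X₀ K = specTo X₀ K := by
  rw [specAut, specTo, ← Category.assoc, ← Spec.map_comp, ← CommRingCat.ofHom_comp]
  congr 3
  ext x
  exact σ.commutes x

lemma specAut_one : specAut (1 : K ≃ₐ[X₀.functionField] K) = 𝟙 _ :=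
  Spec.map_id _

lemma specAut_mul (σ τ : K ≃ₐ[X₀.functionField] K) :
    specAut (σ * τ) = specAut σ ≫ specAut τ := by
  rw [specAut, specAut, specAut, ← Spec.map_comp, ← CommRingCat.ofHom_comp]
  rfl

/-- The endomorphism `Spec(σ)` of `𝔛` over `𝔛₀` induced by `σ ∈ Gal(K/K₀)`; on an affine piece
`𝔛 = Spec R` it is `𝔭 ↦ σ⁻¹(𝔭)`. -/
def galMap (σ : K ≃ₐ[X₀.functionField] K) : normalizationIn X₀ K ⟶ normalizationIn X₀ K :=
  (specTo X₀ K).normalizationDesc (specAut σ ≫ (specTo X₀ K).toNormalization)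
    (specTo X₀ K).fromNormalization
    (by rw [Category.assoc, Scheme.Hom.toNormalization_fromNormalization, specAut_specTo])

lemma galMap_normalizationMap (σ : K ≃ₐ[X₀.functionField] K) :
    galMap σ ≫ normalizationMap X₀ K = normalizationMap X₀ K :=
  Scheme.Hom.normalizationDesc_comp ..

lemma toNormalization_galMap (σ : K ≃ₐ[X₀.functionField] K) :
    (specTo X₀ K).toNormalization ≫ galMap σ = specAut σ ≫ (specTo X₀ K).toNormalization :=
  Scheme.Hom.toNormalization_normalizationDesc ..

lemma galMap_one : galMap (1 : K ≃ₐ[X₀.functionField] K) = 𝟙 _ := by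
  refine Scheme.Hom.normalization.hom_ext (specTo X₀ K) _ _ (normalizationMap X₀ K) ?_
    (galMap_normalizationMap _) (Category.id_comp _)
  rw [toNormalization_galMap, specAut_one, Category.id_comp]
  exact (Category.comp_id _).symm

lemma galMap_mul (σ τ : K ≃ₐ[X₀.functionField] K) :
    galMap (σ * τ) = galMap σ ≫ galMap τ := by
  refine Scheme.Hom.normalization.hom_ext (specTo X₀ K) _ _ (normalizationMap X₀ K) ?_
    (galMap_normalizationMap _) ?_
  · rw [toNormalization_galMap, specAut_mul, ← Category.assoc, toNormalization_galMap,
      Category.assoc, Category.assoc, toNormalization_galMap]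
  · rw [Category.assoc, galMap_normalizationMap, galMap_normalizationMap]

end Normalization

/-! ### The spaces with their `𝒩`-action -/

section Dot

variable (X₀ : Scheme.{u}) [IsArithmetic X₀]
  (K : Type u) [Field K] [Algebra X₀.functionField K] (C : Type v) [Field C]

/-- The set of pairs `(x, χ)`, where `x ∈ 𝔛` and `χ : κ(x)ˣ → Cˣ` is a homomorphism
such that `(ker χ)_tors` is finite. -/
abbrev DotX : Type (max u v) := CharPoint (normalizationIn X₀ K) C

variable {X₀ K C}

/-- The right action of `G = Gal(K/K₀)`: `(x, χ)^σ = (σ⁻¹(x), χ ∘ σ)`. -/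
instance : MulAction (K ≃ₐ[X₀.functionField] K)ᵐᵒᵖ (DotX X₀ K C) where
  smul σ P := P.map (galMap σ.unop)
  one_smul P := by
    change P.map (galMap 1) = P
    rw [galMap_one, CharPoint.map_id]
  mul_smul σ τ P := by
    change P.map (galMap (τ.unop * σ.unop)) = (P.map (galMap τ.unop)).map (galMap σ.unop)
    rw [galMap_mul, CharPoint.map_comp]

lemma gal_smul_def (σ : (K ≃ₐ[X₀.functionField] K)ᵐᵒᵖ) (P : DotX X₀ K C) :
    σ • P = P.map (galMap σ.unop) := rfl

instance : SMulCommClass ℕ+ (K ≃ₐ[X₀.functionField] K)ᵐᵒᵖ (DotX X₀ K C) where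
  smul_comm ν σ P := (CharPoint.map_smul (galMap σ.unop) ν P).symm

variable (X₀ K C)

/-- The quotient by the Galois action. -/
def DotX₀ : Type (max u v) :=
  MulAction.orbitRel.Quotient (K ≃ₐ[X₀.functionField] K)ᵐᵒᵖ (DotX X₀ K C)

variable {X₀ K C}

/-- The projection onto the quotient by the Galois action. -/
def DotX₀.mk (P : DotX X₀ K C) : DotX₀ X₀ K C := Quotient.mk _ P

/-- The action of `𝒩` on the quotient: `F_ν` of the class of `P` is the class of `F_ν P`. -/
instance : MulAction ℕ+ (DotX₀ X₀ K C) where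
  smul ν := Quotient.map (ν • ·) (by
    rintro P Q ⟨σ, rfl⟩
    exact ⟨σ, (smul_comm ν σ Q).symm⟩)
  one_smul := by
    rintro ⟨P⟩
    exact congrArg DotX₀.mk (one_smul ℕ+ P)
  mul_smul := by
    rintro ν ν' ⟨P⟩
    exact congrArg DotX₀.mk (mul_smul ν ν' P)

lemma DotX₀.smul_mk (ν : ℕ+) (P : DotX X₀ K C) : ν • DotX₀.mk P = DotX₀.mk (ν • P) := rfl

/-- The projection to `𝔛₀`, sending the class of `(x, χ)` to `π(x)`. -/
def DotX₀.pr : DotX₀ X₀ K C → X₀ :=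
  Quotient.lift (fun P : DotX X₀ K C => normalizationMap X₀ K P.pt) (by
    rintro P Q ⟨σ, rfl⟩
    change (galMap σ.unop ≫ normalizationMap X₀ K) Q.pt = _
    rw [galMap_normalizationMap])

lemma DotX₀.pr_mk (P : DotX X₀ K C) : (DotX₀.mk P).pr = normalizationMap X₀ K P.pt := rfl

lemma DotX₀.pr_smul (ν : ℕ+) (P : DotX₀ X₀ K C) : (ν • P).pr = P.pr := by
  obtain ⟨P⟩ := P
  rfl

end Dot

/-! ### The colimit over `𝒩` and its `ℚ^{>0}`-action -/

section Colim

variable (S : Type*) [MulAction ℕ+ S]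

/-- Two elements `x` at stage `m` and `y` at stage `n` of the system of copies of `S` indexed by
`𝒩`, ordered by divisibility, with transition map `F_{n/m}` for `m ∣ n`, become equal at the
common later stage `k * m * n`, for some `k`. -/
def colimSetoid : Setoid (S × ℕ+) where
  r a b := ∃ k : ℕ+, (k * b.2) • a.1 = (k * a.2) • b.1
  iseqv :=
    { refl := fun _ => ⟨1, rfl⟩
      symm := fun ⟨k, h⟩ => ⟨k, h.symm⟩
      trans := by
        rintro ⟨x, m⟩ ⟨y, n⟩ ⟨z, l⟩ ⟨k, h⟩ ⟨k', h'⟩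
        refine ⟨k * k' * n, ?_⟩
        dsimp only at h h' ⊢
        calc (k * k' * n * l) • x = (k' * l) • (k * n) • x := by
              rw [← mul_smul]; congr 1; ac_rfl
          _ = (k * m) • (k' * l) • y := by
              rw [h, ← mul_smul, ← mul_smul]; congr 1; ac_rfl
          _ = (k * k' * n * m) • z := by
              rw [h', ← mul_smul]; congr 1; ac_rfl }

/-- The colimit over `𝒩`, ordered by divisibility, of copies of the `𝒩`-set `S`, with transition
map `F_{n/m}` from the `m`-th to the `n`-th copy for `m ∣ n`. -/
def NColim : Type _ := Quotient (colimSetoid S)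

variable {S}

/-- The image `F_n⁻¹(x)` in the colimit of the element `x` of the `n`-th copy. -/
def NColim.mk (x : S) (n : ℕ+) : NColim S := Quotient.mk (colimSetoid S) (x, n)

lemma NColim.mk_eq_mk {x y : S} {m n : ℕ+} :
    NColim.mk x m = NColim.mk y n ↔ ∃ k : ℕ+, (k * n) • x = (k * m) • y :=
  Quotient.eq (r := colimSetoid S)

lemma NColim.mk_smul_mul (k : ℕ+) (x : S) (n : ℕ+) :
    NColim.mk (k • x) (k * n) = NColim.mk x n :=
  NColim.mk_eq_mk.2 ⟨1, by rw [← mul_smul]; congr 1; ac_rfl⟩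

/-- The map `F_a ∘ F_b⁻¹` on the colimit. -/
def NColim.act (a b : ℕ+) : NColim S → NColim S :=
  Quotient.lift (fun x : S × ℕ+ => NColim.mk (a • x.1) (b * x.2)) (by
    rintro ⟨x, m⟩ ⟨y, n⟩ ⟨k, h⟩
    refine NColim.mk_eq_mk.2 ⟨k, ?_⟩
    dsimp only at h ⊢
    calc (k * (b * n)) • a • x = (a * b) • (k * n) • x := by
          rw [← mul_smul, ← mul_smul]; congr 1; ac_rfl
      _ = (k * (b * m)) • a • y := by
          rw [h, ← mul_smul, ← mul_smul]; congr 1; ac_rfl)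

lemma NColim.act_mk (a b : ℕ+) (x : S) (n : ℕ+) :
    NColim.act a b (NColim.mk x n) = NColim.mk (a • x) (b * n) := rfl

lemma NColim.act_congr {a b a' b' : ℕ+} (h : a * b' = a' * b) (z : NColim S) :
    NColim.act a b z = NColim.act a' b' z := by
  obtain ⟨⟨x, n⟩⟩ := z
  refine NColim.mk_eq_mk.2 ⟨1, ?_⟩
  dsimp only
  rw [← mul_smul, ← mul_smul]
  congr 1
  calc 1 * (b' * n) * a = (a * b') * n := by rw [one_mul]; ac_rfl
    _ = 1 * (b * n) * a' := by rw [h, one_mul]; ac_rfl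

/-- The multiplicative group of positive rational numbers. -/
abbrev PosRat : Type := {q : ℚ // 0 < q}

/-- The numerator of a positive rational number. -/
def PosRat.num (q : PosRat) : ℕ+ :=
  ⟨q.1.num.toNat, by have := Rat.num_pos.2 q.2; omega⟩

/-- The denominator of a positive rational number. -/
def PosRat.den (q : PosRat) : ℕ+ := ⟨q.1.den, q.1.den_pos⟩

lemma PosRat.num_eq (q : PosRat) : ((q.num : ℕ) : ℚ) = q.1 * ((q.den : ℕ) : ℚ) := by
  have h : (((q.num : ℕ) : ℤ)) = q.1.num := Int.toNat_of_nonneg (Rat.num_pos.2 q.2).le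
  have h' : ((q.num : ℕ) : ℚ) = (q.1.num : ℚ) := by rw [← h]; norm_cast
  rw [h']
  exact (Rat.mul_den_eq_num q.1).symm

lemma PosRat.cross_eq {q : PosRat} {a b : ℕ+} (h : q.1 * ((b : ℕ) : ℚ) = ((a : ℕ) : ℚ)) :
    q.num * b = a * q.den := by
  have : ((q.num : ℕ) : ℚ) * ((b : ℕ) : ℚ) = ((a : ℕ) : ℚ) * ((q.den : ℕ) : ℚ) := by
    rw [q.num_eq, ← h]; ring
  refine PNat.eq ?_
  rw [PNat.mul_coe, PNat.mul_coe]
  exact_mod_cast this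

/-- The action of `ℚ^{>0}` on the colimit: `q = a / b` acts by `F_a ∘ F_b⁻¹`. -/
instance : MulAction PosRat (NColim S) where
  smul q := NColim.act q.num q.den
  one_smul := by
    rintro ⟨⟨x, n⟩⟩
    change NColim.act _ _ (NColim.mk x n) = NColim.mk x n
    rw [NColim.act_congr (a' := 1) (b' := 1) (PosRat.cross_eq (by simp)), NColim.act_mk,
      one_smul, one_mul]
  mul_smul q r := by
    rintro ⟨⟨x, n⟩⟩
    change NColim.act _ _ (NColim.mk x n) = NColim.act _ _ (NColim.act _ _ (NColim.mk x n))
    rw [NColim.act_congr (a' := q.num * r.num) (b' := q.den * r.den) (PosRat.cross_eq (by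
      rw [PNat.mul_coe, PNat.mul_coe]
      push_cast
      rw [q.num_eq, r.num_eq, Positive.val_mul]
      ring)), NColim.act_mk, NColim.act_mk, NColim.act_mk, mul_smul, mul_assoc]

lemma NColim.smul_mk {q : PosRat} {a b : ℕ+} (h : q.1 * ((b : ℕ) : ℚ) = ((a : ℕ) : ℚ))
    (x : S) (n : ℕ+) : q • NColim.mk x n = NColim.mk (a • x) (b * n) :=
  NColim.act_congr (PosRat.cross_eq h) _

end Colim

section Check

variable (X₀ : Scheme.{u}) [IsArithmetic X₀]
  (K : Type u) [Field K] [Algebra X₀.functionField K] (C : Type v) [Field C]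

/-- The `ℚ^{>0}`-set attached to `𝔛₀`, the colimit over `𝒩` of the `𝒩`-set `DotX₀`. -/
abbrev CheckX₀ : Type (max u v) := NColim (DotX₀ X₀ K C)

variable {X₀ K C}

/-- The projection `pr₀` to `𝔛₀`, sending `F_n⁻¹(P)` to the image of `P`. -/
def CheckX₀.pr : CheckX₀ X₀ K C → X₀ :=
  Quotient.lift (fun x : DotX₀ X₀ K C × ℕ+ => x.1.pr) (by
    rintro ⟨P, m⟩ ⟨Q, n⟩ ⟨k, h⟩
    have := congrArg DotX₀.pr h
    rwa [DotX₀.pr_smul, DotX₀.pr_smul] at this)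

end Check

/-- The number `|k ∩ 𝔽̄_p|` of elements of a field `k` of characteristic `p > 0` that are algebraic
over its prime field `𝔽_p` (the smallest subfield `⊥` of `k`). -/
def constantsCard (k : Type*) [Field k] : ℕ :=
  Nat.card (algebraicClosure (⊥ : Subfield k) k)

end ArithDyn

end

open ArithDyn

/-! Write $q=a/b$ in lowest terms, let $P_0$ come from $(x,\chi)$, and put $L=\kappa(x)$,
$k=\kappa(\mathfrak x_0)$. That $q$ fixes $P_0$ means: some $\sigma\in G$ fixes $x$, and the
endomorphism $\varphi$ of $L$ over $k$ that it induces satisfies $\chi(y)^{Na}=\chi(\varphi y)^{Nb}$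
for some $N\ge 1$ (`smul_map_galMap_eq_smul_iff`, `CheckX₀.exists_of_smul_eq`).

(a) $L$ is again radicially closed, so roots of unity can be divided by $N$ and by the order of
$(\ker\chi)_{\mathrm{tors}}$. This removes $\chi$ from the relation: $y^a=\varphi(y)^b$ for every
root of unity $y$. A primitive $l$-th root of unity with $l\mid ab$ would contradict coprimality, so
every prime dividing $ab$ vanishes in $L$. Thus $q\neq1$ forces characteristic $p>0$ and $q=p^{\pm
m}$. On roots of unity of $k$, where $\varphi$ is trivial, $y^{p^m}=y$; hence the constants of $k$
form a finite field contained in $\mathbb F_{p^m}$, and $p^m$ is a power of its order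
(`exists_zpow_constantsCard_eq`).

(b) The field $k$ is finitely generated over $\mathbb F_p$, so some $p^M$-Frobenius with $M>0$ fixes
its constants. Separable constants are linearly disjoint from $k$, and $L/k$ is normal, so this
Frobenius on the constants of $L$ extends to some $\tau\in\operatorname{Aut}(L/k)$
(`exists_algEquiv_eq_pow`). The decomposition group surjects onto $\operatorname{Aut}(L/k)$, so
$\tau$ comes from some $\sigma\in G$. It remains to find $\chi$, injective on roots of unity, with
$\chi\circ\tau=\chi^{p^M}$ (`exists_char_of_pow_action`): roots of unity embed into $\mathbb
C^\times$ by Teichmüller lifts, and the embedding extends because $\mathbb C^\times$ is divisible.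
Then $p^M$ fixes the class of $(x,\chi)$. -/

/-! ### Linear disjointness from separable constant extensions. -/

open Polynomial in
/-- If `F` is algebraically closed in `k`, minimal polynomials of algebraic elements do not change
under passing from `F` to `k`. -/
lemma minpoly_map_of_algebraicallyClosed {F k L : Type*} [Field F] [Field k] [Field L]
    [Algebra F k] [Algebra k L] [Algebra F L] [IsScalarTower F k L]
    (h : ∀ x : k, IsIntegral F x → x ∈ (algebraMap F k).range) {θ : L} (hθ : IsIntegral F θ) :
    (minpoly F θ).map (algebraMap F k) = minpoly k θ := by
  have hk : IsIntegral k θ := hθ.tower_top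
  have hdvd := minpoly.dvd_map_of_isScalarTower F k θ
  -- A monic factor over `k` of a monic polynomial over `F` has coefficients integral over `F`, so
  -- they already lie in `F`.
  have hlift : minpoly k θ ∈ Polynomial.lifts (algebraMap F k) := by
    rw [Polynomial.lifts_iff_coeff_lifts]
    exact fun n => h _ (Polynomial.isIntegral_coeff_of_dvd _ _ (minpoly.monic hθ)
      (minpoly.monic hk) hdvd n)
  obtain ⟨g, hg, -, hgm⟩ := Polynomial.lifts_and_natDegree_eq_and_monic hlift (minpoly.monic hk)
  have hg0 : aeval θ g = 0 := by
    rw [← aeval_map_algebraMap k, hg, minpoly.aeval]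
  refine (Polynomial.eq_of_monic_of_dvd_of_natDegree_le (minpoly.monic hk)
    ((minpoly.monic hθ).map _) hdvd ?_)
  rw [← hg, natDegree_map, natDegree_map]
  exact natDegree_le_of_dvd (minpoly.dvd F θ hg0) hgm.ne_zero

/-- A finite separable extension of a field `F` is linearly disjoint from every extension of `F`
in which `F` is algebraically closed. -/
lemma IntermediateField.linearDisjoint_of_algebraicallyClosed_of_finite {F k L : Type*} [Field F]
    [Field k] [Field L] [Algebra F k] [Algebra k L] [Algebra F L] [IsScalarTower F k L]
    (h : ∀ x : k, IsIntegral F x → x ∈ (algebraMap F k).range) (E : IntermediateField F L)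
    [FiniteDimensional F E] [Algebra.IsSeparable F E] : E.LinearDisjoint k := by
  let pb : PowerBasis F E := Field.powerBasisOfFiniteOfSeparable F E
  have hint : IsIntegral F (pb.gen : L) := (pb.isIntegral_gen).map E.val
  refine .of_basis_left pb.basis ?_
  have h1 := linearIndependent_pow (K := k) (pb.gen : L)
  have hdim : pb.dim = (minpoly k (pb.gen : L)).natDegree := by
    rw [← minpoly_map_of_algebraicallyClosed h hint, Polynomial.natDegree_map,
      ← pb.natDegree_minpoly]
    congr 1
    exact (minpoly.algebraMap_eq (algebraMap E L).injective pb.gen).symm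
  convert! h1.comp (Fin.cast hdim) (Fin.cast_injective _) using 1
  ext i
  simp only [Function.comp_apply, PowerBasis.basis_eq_pow, map_pow, Fin.val_cast]
  rfl

/-- A separable algebraic extension of a field `F` is linearly disjoint from every extension of `F`
in which `F` is algebraically closed. -/
lemma IntermediateField.linearDisjoint_of_algebraicallyClosed {F k L : Type*} [Field F] [Field k]
    [Field L] [Algebra F k] [Algebra k L] [Algebra F L] [IsScalarTower F k L]
    (h : ∀ x : k, IsIntegral F x → x ∈ (algebraMap F k).range) (E : IntermediateField F L)
    [Algebra.IsSeparable F E] : E.LinearDisjoint k := by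
  obtain ⟨⟨ι, b⟩⟩ := Module.Free.exists_basis (R := F) (M := E)
  have hb : LinearIndependent F (fun i => (b i : L)) :=
    b.linearIndependent.map' E.val.toLinearMap (LinearMap.ker_eq_bot.2 E.val.injective)
  refine .of_basis_left b ?_
  -- Finitely many basis vectors lie in a finite separable subextension, where a primitive element
  -- is available.
  rw [linearIndependent_iff_finset_linearIndependent]
  intro s
  let v : s → L := fun i => b i
  let E' : IntermediateField F L := IntermediateField.adjoin F (Set.range v)
  have hle : E' ≤ E := IntermediateField.adjoin_le_iff.2 (by rintro _ ⟨i, rfl⟩; exact (b i).2)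
  have : FiniteDimensional F E' := by
    refine IntermediateField.finiteDimensional_adjoin ?_
    rintro _ ⟨i, rfl⟩
    exact (Algebra.IsIntegral.isIntegral (R := F) (b i)).map E.val
  have : Algebra.IsSeparable F E' :=
    Algebra.IsSeparable.of_algHom F E (IntermediateField.inclusion hle)
  let w : s → E' := fun i => ⟨v i, IntermediateField.subset_adjoin _ _ ⟨i, rfl⟩⟩
  have hw : LinearIndependent F w :=
    LinearIndependent.of_comp E'.val.toLinearMap (hb.comp _ Subtype.val_injective)
  exact (linearDisjoint_of_algebraicallyClosed_of_finite h E').linearIndependent_left hw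

/-- If `Φ` is an endomorphism over `F` of a separable algebraic subextension `E/F` of a normal
extension `L/k`, and `F` is algebraically closed in `k`, then `Φ` extends to `L` over `k`. -/
lemma IntermediateField.exists_algEquiv_extending {F k L : Type*} [Field F] [Field k]
    [Field L] [Algebra F k] [Algebra k L] [Algebra F L] [IsScalarTower F k L] [Normal k L]
    (h : ∀ x : k, IsIntegral F x → x ∈ (algebraMap F k).range) (E : IntermediateField F L)
    [Algebra.IsSeparable F E] (Φ : E →ₐ[F] L) : ∃ τ : L ≃ₐ[k] L, ∀ z : E, τ z = Φ z := by
  have hE := linearDisjoint_of_algebraicallyClosed h E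
  have hfield := hE.isField_of_isAlgebraic (.inl (inferInstance : Algebra.IsAlgebraic F E))
  have hfield : IsField (TensorProduct F k E) :=
    (Algebra.TensorProduct.comm F k E).toMulEquiv.isField hfield
  -- By disjointness $k\otimes_F E$ is a field, so `μ` identifies it with the compositum $kE$. Then
  -- $\nu\circ\mu^{-1}$ extends `Φ` to $kE$ over `k`, and normality extends it to `L`.
  let μ : TensorProduct F k E →ₐ[k] L :=
    Algebra.TensorProduct.lift (Algebra.ofId k L) E.val fun _ _ => Commute.all _ _
  let ν : TensorProduct F k E →ₐ[k] L :=
    Algebra.TensorProduct.lift (Algebra.ofId k L) Φ fun _ _ => Commute.all _ _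
  have hμ : Function.Injective μ := by
    rw [injective_iff_map_eq_zero]
    intro x hx
    by_contra hx0
    obtain ⟨y, hy⟩ := hfield.mul_inv_cancel hx0
    have := congrArg μ hy
    rw [map_mul, hx, zero_mul] at this
    exact zero_ne_one (this.trans μ.toRingHom.map_one)
  let R : Subalgebra k L := μ.range
  let E₁ : IntermediateField k L := { R with
    inv_mem' := fun x hx => R.inv_mem_of_algebraic (x := ⟨x, hx⟩) (Algebra.IsAlgebraic.isAlgebraic _) }
  let f : E₁ →ₐ[k] L := ν.comp (AlgEquiv.ofInjective μ hμ).symm.toAlgHom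
  obtain ⟨φ, hφ⟩ := IntermediateField.exists_algHom_of_splits (normal_iff.1 ‹Normal k L›) f
  refine ⟨AlgEquiv.ofBijective φ (φ.normal_bijective k L L), fun z => ?_⟩
  have hz : μ (TensorProduct.tmul F 1 z) = z := by simp [μ]
  have := DFunLike.congr_fun hφ ⟨z, ⟨_, hz⟩⟩
  refine this.trans ?_
  change ν ((AlgEquiv.ofInjective μ hμ).symm _) = _
  have h2 : (AlgEquiv.ofInjective μ hμ).symm ⟨z, ⟨_, hz⟩⟩ = TensorProduct.tmul F 1 z := by
    rw [AlgEquiv.symm_apply_eq]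
    exact Subtype.ext hz.symm
  erw [h2]
  simp [ν]

/-! ### Constants of finitely generated fields, and Frobenius on them. -/

/-- Powers of an algebraic element stay linearly independent over a purely transcendental
extension. -/
lemma AlgebraicIndependent.natDegree_minpoly_le_finrank {F k : Type*} [Field F] [Field k]
    [Algebra F k] {s : Set k} (hs : AlgebraicIndependent F ((↑) : s → k))
    [Module.Finite (IntermediateField.adjoin F s) k] {x : k} (hx : IsIntegral F x) :
    (minpoly F x).natDegree ≤ Module.finrank (IntermediateField.adjoin F s) k := by
  classical
  let E := IntermediateField.adjoin F {x}
  have : Algebra.IsAlgebraic F E := IntermediateField.isAlgebraic_adjoin (by simpa using hx)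
  have hsE : AlgebraicIndependent E ((↑) : s → k) := hs.extendScalars E
  let g : E := IntermediateField.AdjoinSimple.gen F x
  have hg : LinearIndependent F (fun i : Fin (minpoly F x).natDegree => g ^ (i : ℕ)) := by
    have : minpoly F g = minpoly F x := IntermediateField.minpoly_gen F x
    rw [← this]
    exact linearIndependent_pow g
  have key : LinearIndependent (Algebra.adjoin F s)
      (fun i : Fin (minpoly F x).natDegree => x ^ (i : ℕ)) := by
    rw [Fintype.linearIndependent_iff]
    intro f hf i
    have hp : ∀ i, ∃ P : MvPolynomial s F, MvPolynomial.aeval ((↑) : s → k) P = f i := fun i => by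
      have h := Algebra.adjoin_range_eq_range_aeval F ((↑) : s → k)
      rw [Subtype.range_coe] at h
      exact h.le (f i).2
    choose P hP using hp
    -- A relation among the powers of `x` with coefficients in $F[s]$ is a polynomial over $E=F(x)$
    -- vanishing at `s`. As `s` stays algebraically independent over `E`, each coefficient is an
    -- `F`-relation among the powers of `x` below its degree.
    let Q : MvPolynomial s E := ∑ i : Fin (minpoly F x).natDegree, MvPolynomial.C (g ^ (i : ℕ)) *
      MvPolynomial.map (algebraMap F E) (P i)
    have hQ : MvPolynomial.aeval ((↑) : s → k) Q = 0 := by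
      rw [← hf, map_sum]
      refine Finset.sum_congr rfl fun i _ => ?_
      rw [map_mul, MvPolynomial.aeval_C, MvPolynomial.aeval_map_algebraMap, hP, Algebra.smul_def,
        mul_comm, map_pow]
      rfl
    have hQ0 : Q = 0 := (injective_iff_map_eq_zero _).1 hsE _ hQ
    have hPi : P i = 0 := by
      ext m
      have := congrArg (MvPolynomial.coeff m) hQ0
      simp only [Q, MvPolynomial.coeff_sum, MvPolynomial.coeff_C_mul, MvPolynomial.coeff_map,
        MvPolynomial.coeff_zero] at this
      refine Fintype.linearIndependent_iff.1 hg (fun i => (P i).coeff m) ?_ i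
      rw [← this]
      refine Finset.sum_congr rfl fun i _ => ?_
      rw [Algebra.smul_def, mul_comm]
    exact Subtype.ext (by rw [← hP, hPi, map_zero]; rfl)
  have key' : LinearIndependent (IntermediateField.adjoin F s)
      (fun i : Fin (minpoly F x).natDegree => x ^ (i : ℕ)) := by
    open scoped IntermediateField.algebraAdjoinAdjoin in
    exact (LinearIndependent.iff_fractionRing (Algebra.adjoin F s) _).1 key
  simpa using key'.fintype_card_le_finrank

/-- An element of degree $n$ lies in $\mathbb F_{p^n}$, and $n\mid d!$ whenever $n\le d$; the
factorial gives one exponent for all degrees up to `d`. -/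
lemma FiniteField.pow_pow_factorial_eq_of_natDegree_le {p : ℕ} [Fact p.Prime] {k : Type*} [Field k]
    [Algebra (ZMod p) k] {x : k} (hx : IsIntegral (ZMod p) x) {d : ℕ}
    (hd : (minpoly (ZMod p) x).natDegree ≤ d) : x ^ p ^ d.factorial = x := by
  let E := IntermediateField.adjoin (ZMod p) {x}
  have : FiniteDimensional (ZMod p) E := IntermediateField.adjoin.finiteDimensional hx
  have : Finite E := Module.finite_of_finite (ZMod p)
  have : Fintype E := Fintype.ofFinite E
  let g : E := IntermediateField.AdjoinSimple.gen (ZMod p) x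
  have hcard : Fintype.card E = p ^ (minpoly (ZMod p) x).natDegree := by
    rw [Module.card_eq_pow_finrank (K := ZMod p), ZMod.card, IntermediateField.adjoin.finrank hx]
  have h1 : g ^ p ^ (minpoly (ZMod p) x).natDegree = g := by
    rw [← hcard, FiniteField.pow_card]
  obtain ⟨c, hc⟩ := Nat.dvd_factorial (minpoly.natDegree_pos hx) hd
  have h2 : ∀ c : ℕ, g ^ p ^ ((minpoly (ZMod p) x).natDegree * c) = g := fun c => by
    induction c with
    | zero => simp
    | succ c ih => rw [mul_add_one, pow_add, pow_mul, ih, h1]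
  have := congrArg (algebraMap E k) (h2 c)
  rwa [← hc, map_pow] at this

/-- The elements of a finitely generated field of characteristic `p` that are algebraic over the
prime field are fixed by a power of Frobenius. -/
lemma exists_pow_eq_of_essFiniteType (p : ℕ) [Fact p.Prime] (k : Type*) [Field k]
    [Algebra (ZMod p) k] [Algebra.EssFiniteType (ZMod p) k] :
    ∃ M : ℕ, 0 < M ∧ ∀ x : k, IsIntegral (ZMod p) x → x ^ p ^ M = x := by
  obtain ⟨s, hs⟩ := exists_finset_isTranscendenceBasis (ZMod p) k
  have : Algebra.IsAlgebraic (IntermediateField.adjoin (ZMod p) (s : Set k)) k := by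
    convert! hs.isAlgebraic_field <;> simp
  have : Algebra.EssFiniteType (IntermediateField.adjoin (ZMod p) (s : Set k)) k :=
    .of_comp (ZMod p) _ _
  have : Module.Finite (IntermediateField.adjoin (ZMod p) (s : Set k)) k :=
    Algebra.finite_of_essFiniteType_of_isAlgebraic
  exact ⟨_, Nat.factorial_pos _, fun x hx =>
    FiniteField.pow_pow_factorial_eq_of_natDegree_le hx (hs.1.natDegree_minpoly_le_finrank hx)⟩

/-- In a normal extension `L/k` in characteristic `p`, the Frobenius `z ↦ z ^ p ^ M` on the
constants of `L` extends to `L/k` if it fixes the constants of `k`. -/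
lemma exists_algEquiv_eq_pow {p : ℕ} [Fact p.Prime] {k L : Type*} [Field k] [Field L]
    [Algebra (ZMod p) k] [Algebra (ZMod p) L] [Algebra k L] [Normal k L] {M : ℕ}
    (hM : ∀ x : k, IsIntegral (ZMod p) x → x ^ p ^ M = x) :
    ∃ τ : L ≃ₐ[k] L, ∀ z : L, IsIntegral (ZMod p) z → τ z = z ^ p ^ M := by
  have : IsScalarTower (ZMod p) k L := .of_algebraMap_eq' (Subsingleton.elim _ _)
  have : CharP L p := charP_of_injective_algebraMap (algebraMap (ZMod p) L).injective p
  have : ExpChar L p := .prime Fact.out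
  let F := algebraicClosure (ZMod p) k
  let E := algebraicClosure F L
  have hperf : PerfectField F := Algebra.IsAlgebraic.perfectField (K := ZMod p)
  have : Algebra.IsAlgebraic F E := algebraicClosure.isAlgebraic F L
  -- The Frobenius power is `F`-linear exactly because `hM` says that it fixes `F`. Separability of
  -- `E/F` comes from `F` being perfect.
  let Φ : E →ₐ[F] L :=
    { toRingHom := (iterateFrobenius L p M).comp (algebraMap E L)
      commutes' := fun r => by
        have hr : IsIntegral (ZMod p) (r : k) := r.2
        change (algebraMap k L r) ^ p ^ M = algebraMap k L r
        rw [← map_pow, hM _ hr] }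
  have hF : ∀ x : k, IsIntegral F x → x ∈ (algebraMap F k).range := fun x hx =>
    ⟨⟨x, isIntegral_trans (R := ZMod p) (A := F) x hx⟩, rfl⟩
  obtain ⟨τ, hτ⟩ := IntermediateField.exists_algEquiv_extending hF E Φ
  exact ⟨τ, fun z hz => hτ ⟨z, IsIntegral.tower_top hz⟩⟩

/-! ### Integral closures in normal extensions. -/

section IntegralClosure

variable {A B K₀ K : Type*} [CommRing A] [CommRing B] [Field K₀] [Field K] [Algebra A B]
  [Algebra A K] [Algebra B K] [IsScalarTower A B K] [IsIntegralClosure B A K]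

open Polynomial in
/-- A monic polynomial over an integral closure `B` in `K` splits over `B` if it does over `K`. -/
lemma IsIntegralClosure.splits_of_splits_map (A : Type*) {B K : Type*} [CommRing A] [CommRing B]
    [Field K] [Algebra A B] [Algebra A K] [Algebra B K] [IsScalarTower A B K]
    [IsIntegralClosure B A K] {f : B[X]} (hf : f.Monic) (h : (f.map (algebraMap B K)).Splits) :
    f.Splits := by
  have hinj : Function.Injective (algebraMap B K) := IsIntegralClosure.algebraMap_injective B A K
  have : IsDomain B := hinj.isDomain
  have : Algebra.IsIntegral A B := IsIntegralClosure.isIntegral_algebra A K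
  refine h.of_splits_map_of_injective hinj fun r hr => ?_
  have hr' : IsIntegral B r := ⟨f, hf, by
    rw [← Polynomial.eval_map]; exact (mem_roots'.1 hr).2⟩
  obtain ⟨b, rfl⟩ := (IsIntegralClosure.isIntegral_iff (A := B)).1 (isIntegral_trans (R := A) r hr')
  exact ⟨b, rfl⟩

variable [Algebra A K₀] [IsFractionRing A K₀] [Algebra K₀ K] [IsScalarTower A K₀ K]
  [IsDomain A] [IsIntegrallyClosed A] [Normal K₀ K]

-- Since `A` is integrally closed, the minimal polynomial over `A` is the one over `K₀`. It splits
-- in the normal extension `K`, and its roots are integral, hence in `B`.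
open Polynomial in
variable (A K₀ K) in
include K₀ K in
lemma IsIntegralClosure.exists_monic_splits (b : B) :
    ∃ f : A[X], f.Monic ∧ aeval b f = 0 ∧ (f.map (algebraMap A B)).Splits := by
  have hinj : Function.Injective (algebraMap B K) := IsIntegralClosure.algebraMap_injective B A K
  have hb : IsIntegral A b := IsIntegralClosure.isIntegral A K b
  have hbK : IsIntegral A (algebraMap B K b) := hb.algebraMap
  refine ⟨minpoly A (algebraMap B K b), minpoly.monic hbK, ?_,
    splits_of_splits_map A (K := K) ((minpoly.monic hbK).map _) ?_⟩
  · apply hinj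
    rw [← aeval_algebraMap_apply, minpoly.aeval, map_zero]
  · rw [Polynomial.map_map, ← IsScalarTower.algebraMap_eq, IsScalarTower.algebraMap_eq A K₀ K,
      ← Polynomial.map_map, ← minpoly.isIntegrallyClosed_eq_field_fractions K₀ K hbK]
    exact Normal.splits ‹_› _

end IntegralClosure

/-! ### Residue extensions and the decomposition group. -/

/-- Every element of the field `L` is a quotient of values of the ring homomorphism `ev`. -/
def IsFractionsOf {B L : Type*} [CommRing B] [Field L] (ev : B →+* L) : Prop :=
  ∀ z : L, ∃ b s : B, ev s ≠ 0 ∧ z * ev s = ev b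

section Decomposition

variable {A B K₀ K k L : Type*} [CommRing A] [CommRing B] [Field K₀] [Field K] [Algebra A B]
  [Algebra A K] [Algebra B K] [IsScalarTower A B K] [IsIntegralClosure B A K]
  [Algebra A K₀] [IsFractionRing A K₀] [Algebra K₀ K] [IsScalarTower A K₀ K]
  [Field k] [Field L] [Algebra A k] [Algebra k L] (ev : B →+* L)
  (hev : ∀ a : A, ev (algebraMap A B a) = algebraMap k L (algebraMap A k a))

open Polynomial

include hev in
lemma eval₂_eq_zero_of_aeval {f : A[X]} {b : B} (hb : aeval b f = 0) :
    aeval (ev b) (f.map (algebraMap A k)) = 0 := by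
  have h : (algebraMap k L).comp (algebraMap A k) = ev.comp (algebraMap A B) :=
    RingHom.ext fun a => (hev a).symm
  rw [aeval_def, eval₂_map, h, ← hom_eval₂, ← aeval_def, hb, map_zero]

variable (A K₀ K) in
include hev K₀ K in
/-- Residue field extensions of the integral closure in a normal extension are normal. -/
lemma normal_of_isFractionsOf [IsDomain A] [IsIntegrallyClosed A] [Normal K₀ K]
    (hfrac : IsFractionsOf ev) : Normal k L := by
  have h : (algebraMap k L).comp (algebraMap A k) = ev.comp (algebraMap A B) :=
    RingHom.ext fun a => (hev a).symm
  -- A value `ev b` is a root of the reduction of a polynomial that splits over `B`; these values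
  -- generate `L` over `k`.
  have key : ∀ x ∈ Set.range ev, IsIntegral k x ∧ ((minpoly k x).map (algebraMap k L)).Splits := by
    rintro _ ⟨b, rfl⟩
    obtain ⟨f, hf, hb, hs⟩ := IsIntegralClosure.exists_monic_splits A K₀ K b
    have h0 := eval₂_eq_zero_of_aeval (k := k) ev hev hb
    refine ⟨⟨_, hf.map _, h0⟩, ?_⟩
    refine Splits.of_dvd (g := (f.map (algebraMap A k)).map (algebraMap k L)) ?_
      ((hf.map _).map _).ne_zero (Polynomial.map_dvd _ (minpoly.dvd k _ h0))
    rw [Polynomial.map_map, h, ← Polynomial.map_map]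
    exact hs.map ev
  have htop : IntermediateField.adjoin k (Set.range ev) = ⊤ := by
    refine top_le_iff.1 fun z _ => ?_
    obtain ⟨b, s, hs, hz⟩ := hfrac z
    rw [(eq_div_iff hs).2 hz]
    exact div_mem (IntermediateField.subset_adjoin _ _ ⟨b, rfl⟩)
      (IntermediateField.subset_adjoin _ _ ⟨s, rfl⟩)
  refine normal_iff.2 fun z => ?_
  have hz : z ∈ IntermediateField.adjoin k (Set.range ev) := htop ▸ IntermediateField.mem_top
  have : Algebra.IsAlgebraic k (IntermediateField.adjoin k (Set.range ev)) :=
    IntermediateField.isAlgebraic_adjoin fun x hx => (key x hx).1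
  exact ⟨(Algebra.IsIntegral.isIntegral (R := k)
    (⟨z, hz⟩ : IntermediateField.adjoin k (Set.range ev))).map
      (IntermediateField.adjoin k (Set.range ev)).val,
    IntermediateField.splits_of_mem_adjoin _ _ key hz⟩

-- Conjugates of `ev b` over `k` are reductions of roots in `B` of a polynomial over `A`, so `τ`
-- preserves the subring `ev(B)` of `L`.
variable (A K₀ K) in
include hev K₀ K in
lemma exists_algEquiv_apply_eq [IsDomain A] [IsIntegrallyClosed A] [Normal K₀ K]
    (τ : L ≃ₐ[k] L) (b : B) :
    ∃ b' : B, τ (ev b) = ev b' := by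
  have h : (algebraMap k L).comp (algebraMap A k) = ev.comp (algebraMap A B) :=
    RingHom.ext fun a => (hev a).symm
  obtain ⟨f, hf, hb, hs⟩ := IsIntegralClosure.exists_monic_splits A K₀ K b
  have h0 : aeval (τ (ev b)) (f.map (algebraMap A k)) = 0 := by
    rw [aeval_algEquiv, AlgHom.comp_apply, eval₂_eq_zero_of_aeval (k := k) ev hev hb, map_zero]
  have : IsDomain B :=
    (IsIntegralClosure.algebraMap_injective B A K).isDomain
  have h1 := hs.eq_prod_roots_of_monic (hf.map _)
  rw [aeval_def, eval₂_map, h, ← eval₂_map, h1, eval₂_multiset_prod, Multiset.prod_eq_zero_iff] at h0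
  simp only [Multiset.map_map, Multiset.mem_map, Function.comp_apply, eval₂_sub, eval₂_X,
    eval₂_C] at h0
  obtain ⟨b', -, hb'⟩ := h0
  exact ⟨b', sub_eq_zero.1 hb'⟩

variable [IsDomain A] [IsIntegrallyClosed A] [IsGalois K₀ K] [MulSemiringAction Gal(K/K₀) B]
  (hG : ∀ (g : Gal(K/K₀)) (b : B), algebraMap B K (g • b) = g (algebraMap B K b))

include hG hev in
/-- The decomposition group surjects onto the automorphism group of the residue extension. -/
lemma exists_galois_smul_eq (τ : L ≃ₐ[k] L) :
    ∃ g : Gal(K/K₀), ∀ b : B, ev (g • b) = τ (ev b) := by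
  have hinj : Function.Injective (algebraMap B K) := IsIntegralClosure.algebraMap_injective B A K
  have hcomm : SMulCommClass Gal(K/K₀) A B := ⟨fun g a b => hinj <| by
    rw [hG, Algebra.smul_def, Algebra.smul_def, map_mul, map_mul, map_mul, hG,
      ← IsScalarTower.algebraMap_apply A B K, IsScalarTower.algebraMap_apply A K₀ K, g.commutes]⟩
  -- The invariants of `B` lie in `K₀` by Galois theory and are integral over `A`, hence lie in `A`.
  have hinv : Algebra.IsInvariant A B Gal(K/K₀) := ⟨fun b hb => by
    obtain ⟨y, hy⟩ := (InfiniteGalois.mem_range_algebraMap_iff_fixed (algebraMap B K b)).2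
      fun g => by rw [← hG, hb]
    have hint : IsIntegral A y := by
      rw [← isIntegral_algebraMap_iff (algebraMap K₀ K).injective, hy]
      exact (IsIntegralClosure.isIntegral A K b).algebraMap
    obtain ⟨a, rfl⟩ := IsIntegrallyClosed.isIntegral_iff.1 hint
    exact ⟨a, hinj (by rw [← hy, ← IsScalarTower.algebraMap_apply,
      ← IsScalarTower.algebraMap_apply])⟩⟩
  -- Elements of `B` have open stabilizers, so the action on discrete `B` is continuous, as the
  -- profinite form of the theorem on decomposition groups requires.
  let _ : TopologicalSpace B := ⊥
  have : DiscreteTopology B := ⟨rfl⟩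
  have : ContinuousSMul Gal(K/K₀) B := by
    rw [continuousSMul_iff_stabilizer_isOpen]
    intro b
    convert stabilizer_isOpen_of_isIntegral (K := K₀) (algebraMap B K b) using 1
    ext g
    change g • b = b ↔ g (algebraMap B K b) = algebraMap B K b
    rw [← hG, hinj.eq_iff]
  let Q : Ideal B := RingHom.ker ev
  have hQ : Q.IsPrime := RingHom.ker_isPrime ev
  let P : Ideal A := Q.under A
  have : Q.LiesOver P := ⟨rfl⟩
  choose t ht using exists_algEquiv_apply_eq A K₀ K ev hev τ
  choose t' ht' using exists_algEquiv_apply_eq A K₀ K ev hev τ.symm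
  let e : B ⧸ Q →+* L := RingHom.kerLift ev
  have he : Function.Injective e := RingHom.kerLift_injective ev
  have hmk : ∀ x : B ⧸ Q, ∃ b, Ideal.Quotient.mk Q b = x := Ideal.Quotient.mk_surjective
  have hex : ∀ x : B ⧸ Q, ∃ y : B ⧸ Q, e y = τ (e x) := fun x => by
    obtain ⟨b, rfl⟩ := hmk x
    exact ⟨Ideal.Quotient.mk Q (t b), (ht b).symm⟩
  have hex' : ∀ x : B ⧸ Q, ∃ y : B ⧸ Q, e y = τ.symm (e x) := fun x => by
    obtain ⟨b, rfl⟩ := hmk x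
    exact ⟨Ideal.Quotient.mk Q (t' b), (ht' b).symm⟩
  choose φ hφ using hex
  choose ψ hψ using hex'
  -- Both `τ` and its inverse preserve $\mathrm{ev}(B)\cong B/Q$, so `τ` restricts to an
  -- automorphism there.
  let τ' : (B ⧸ Q) ≃ₐ[A ⧸ P] (B ⧸ Q) :=
    { toFun := φ
      invFun := ψ
      left_inv := fun x => he (by rw [hψ, hφ, AlgEquiv.symm_apply_apply])
      right_inv := fun x => he (by rw [hφ, hψ, AlgEquiv.apply_symm_apply])
      map_mul' := fun x y => he (by rw [hφ, map_mul, map_mul, map_mul, hφ, hφ])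
      map_add' := fun x y => he (by rw [hφ, map_add, map_add, map_add, hφ, hφ])
      commutes' := fun a => he (by
        obtain ⟨a, rfl⟩ := Ideal.Quotient.mk_surjective a
        rw [hφ]
        change τ (ev (algebraMap A B a)) = ev (algebraMap A B a)
        rw [hev, τ.commutes]) }
  obtain ⟨g, hg⟩ := Ideal.Quotient.stabilizerHom_surjective_of_profinite (G := Gal(K/K₀)) P Q τ'
  refine ⟨g, fun b => ?_⟩
  have := DFunLike.congr_fun hg (Ideal.Quotient.mk Q b)
  have h2 := congrArg e this
  rw [show τ' (Ideal.Quotient.mk Q b) = φ (Ideal.Quotient.mk Q b) from rfl, hφ] at h2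
  exact h2

end Decomposition

/-! ### Characters with prescribed Frobenius behaviour. -/

/-- A prime vanishing in $W(L)$ vanishes in `L`, so it is `p`; but `p` is nonzero in $W(L)$. -/
lemma WittVector.charZero_of_charP (p : ℕ) [hp : Fact p.Prime] (L : Type*) [Field L] [CharP L p] :
    CharZero (WittVector p L) := by
  obtain ⟨l, hl⟩ := CharP.exists (WittVector p L)
  rcases CharP.char_is_prime_or_zero (WittVector p L) l with h | rfl
  · have h1 : ((l : ℕ) : WittVector p L) = 0 := CharP.cast_eq_zero _ _
    have h2 : ((l : ℕ) : L) = 0 := by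
      rw [← map_natCast (WittVector.constantCoeff (p := p) (R := L)), h1, map_zero]
    have h3 : l = p := (Nat.prime_dvd_prime_iff_eq hp.out h).1
      ((CharP.cast_eq_zero_iff L p l).1 h2) |>.symm
    exact absurd (h3 ▸ h1) (WittVector.p_nonzero p L)
  · exact CharP.charP_to_charZero _

/-- The roots of unity of a field of characteristic `p` embed into those of any algebraically closed
field of characteristic zero. -/
lemma exists_torsion_embedding (p : ℕ) [hp : Fact p.Prime] (L : Type*) [Field L] [CharP L p]
    (C : Type*) [Field C] [IsAlgClosed C] [CharZero C] :
    ∃ ψ : CommGroup.torsion Lˣ →* Cˣ, Function.Injective ψ := by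
  have := WittVector.charZero_of_charP p L
  let W := FractionRing (WittVector p L)
  have : CharZero W := charZero_of_injective_algebraMap (IsFractionRing.injective (WittVector p L) W)
  let Qb := algebraicClosure ℚ W
  have : Algebra.IsAlgebraic ℚ Qb := algebraicClosure.isAlgebraic ℚ W
  let j : Qb →ₐ[ℚ] C := IsAlgClosed.lift
  -- The Teichmüller map is multiplicative and injective. It sends roots of unity to roots of unity,
  -- which lie in the algebraic closure of `ℚ` in `W`, and that field embeds into `C`.
  let t : Lˣ →* W := ((algebraMap (WittVector p L) W).toMonoidHom.comp
    (WittVector.teichmuller p)).comp (Units.coeHom L)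
  have ht : Function.Injective t := by
    intro x y hxy
    have h1 : WittVector.teichmuller p (x : L) = WittVector.teichmuller p (y : L) :=
      IsFractionRing.injective (WittVector p L) W hxy
    have h2 := congrArg (fun w => w.coeff 0) h1
    exact Units.ext (by simpa using h2)
  have hint : ∀ x : CommGroup.torsion Lˣ, t (x : Lˣ) ∈ Qb := by
    rintro ⟨x, hx⟩
    obtain ⟨n, hn, hx⟩ := isOfFinOrder_iff_pow_eq_one.1 hx
    refine (IsIntegral.of_pow hn ?_ : IsIntegral ℚ (t x))
    rw [← map_pow, hx, map_one]
    exact isIntegral_one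
  let s : CommGroup.torsion Lˣ →* Qb :=
    { toFun := fun x => ⟨t (x : Lˣ), hint x⟩
      map_one' := Subtype.ext (map_one t)
      map_mul' := fun x y => Subtype.ext (map_mul t (x : Lˣ) (y : Lˣ)) }
  refine ⟨(j.toRingHom.toMonoidHom.comp s).toHomUnits, fun x y hxy => ?_⟩
  have h1 : j (s x) = j (s y) := congrArg (Units.val) hxy
  exact Subtype.ext (ht (congrArg Subtype.val (j.toRingHom.injective h1)))

/-- Homomorphisms into the unit group of an algebraically closed field extend along injections. -/
lemma exists_units_hom_extending {C : Type*} [Field C] [IsAlgClosed C] {M N : Type*} [CommGroup M]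
    [CommGroup N] (f : M →* N) (hf : Function.Injective f) (g : M →* Cˣ) :
    ∃ h : N →* Cˣ, ∀ x, h (f x) = g x := by
  let _ : RootableBy Cˣ ℕ := rootableByOfPowLeftSurj _ _ fun {n} hn c => by
    obtain ⟨z, hz⟩ := IsAlgClosed.exists_pow_nat_eq (c : C) (Nat.pos_of_ne_zero hn)
    have hz0 : z ≠ 0 := by
      rintro rfl
      rw [zero_pow hn] at hz
      exact c.ne_zero hz.symm
    exact ⟨Units.mk0 z hz0, Units.ext (by simpa using hz)⟩
  -- Divisible abelian groups are injective `ℤ`-modules by Baer's criterion.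
  let _ : RootableBy Cˣ ℤ := Group.rootableByIntOfRootableByNat _
  let _ : DivisibleBy (Additive Cˣ) ℤ :=
    { div := fun a n => Additive.ofMul (RootableBy.root a.toMul n)
      div_zero := fun a => congrArg Additive.ofMul (RootableBy.root_zero a.toMul)
      div_cancel := fun {n} a hn => congrArg Additive.ofMul (RootableBy.root_cancel a.toMul hn) }
  obtain ⟨h, hh⟩ := (Module.Baer.of_divisible (Additive Cˣ)).extension_property_addMonoidHom
    (MonoidHom.toAdditive f) hf (MonoidHom.toAdditive g)
  exact ⟨MonoidHom.toAdditive.symm h, fun x => DFunLike.congr_fun hh (Additive.ofMul x)⟩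

/-- If `τ` acts with finite orbits on `L` and by `z ↦ z ^ q` on roots of unity, there is a
character of `Lˣ`, injective on roots of unity, on which `τ` acts as the `q`-th power. -/
lemma exists_char_of_pow_action {L C : Type*} [Field L] [Field C] [IsAlgClosed C] (τ : Lˣ →* Lˣ)
    {q : ℕ} (hq : 2 ≤ q) (horb : ∀ x, ∃ n, 0 < n ∧ (τ^[n]) x = x)
    (htors : ∀ x, IsOfFinOrder x → τ x = x ^ q)
    (ψ : CommGroup.torsion Lˣ →* Cˣ) (hψ : Function.Injective ψ) :
    ∃ χ : Lˣ →* Cˣ, (∀ x, IsOfFinOrder x → χ x = 1 → x = 1) ∧ ∀ x, χ (τ x) = χ x ^ q := by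
  -- The equation $\chi\circ\tau=\chi^q$ says that `χ` is trivial on the image of `δ`, so `χ` is
  -- built on the quotient. What must be checked is that torsion injects into it.
  let δ : Lˣ →* Lˣ := τ / powMonoidHom q
  have hδ : ∀ x, δ x = τ x / x ^ q := fun x => rfl
  let f : CommGroup.torsion Lˣ →* Lˣ ⧸ δ.range :=
    (QuotientGroup.mk' δ.range).comp (CommGroup.torsion Lˣ).subtype
  have hf : Function.Injective f := by
    rw [injective_iff_map_eq_one]
    rintro ⟨t, ht⟩ h1
    obtain ⟨y, hy⟩ : t ∈ δ.range := (QuotientGroup.eq_one_iff t).1 h1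
    obtain ⟨n, hn, htn⟩ := isOfFinOrder_iff_pow_eq_one.1 ht
    -- With `t = δ y` and `t ^ n = 1`, the finite orbit of `y ^ n` gives $(y^n)^{q^m}=y^n$ with
    -- $q^m>1$. So `y` is torsion, where `δ` is trivial, and `t = 1`.
    have hw : τ (y ^ n) = (y ^ n) ^ q := by
      rw [← div_eq_one, ← hδ, map_pow, hy, htn]
    have hiter : ∀ m : ℕ, (τ^[m]) (y ^ n) = (y ^ n) ^ q ^ m := fun m => by
      induction m with
      | zero => simp
      | succ m ih => rw [Function.iterate_succ_apply', ih, map_pow, hw, ← pow_mul, pow_succ']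
    obtain ⟨m, hm, hm'⟩ := horb (y ^ n)
    have hy' : IsOfFinOrder y := by
      refine isOfFinOrder_iff_pow_eq_one.2 ⟨n * (q ^ m - 1), ?_, ?_⟩
      · have : 1 < q ^ m := Nat.one_lt_pow hm.ne' hq
        exact Nat.mul_pos hn (by omega)
      · have h2 : (y ^ n) ^ q ^ m = y ^ n := by rw [← hiter, hm']
        have h3 : q ^ m = (q ^ m - 1) + 1 := (Nat.sub_add_cancel (Nat.one_le_pow _ _ (by omega))).symm
        rw [h3, pow_succ] at h2
        rw [pow_mul]
        exact mul_eq_right.1 h2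
    refine Subtype.ext ?_
    change t = 1
    rw [← hy, hδ, htors y hy', div_self']
  obtain ⟨h, hh⟩ := exists_units_hom_extending (M := CommGroup.torsion Lˣ)
    (N := Lˣ ⧸ δ.range) f hf ψ
  refine ⟨h.comp (QuotientGroup.mk' _), fun x hx h1 => ?_, fun x => ?_⟩
  · have h2 : ψ ⟨x, hx⟩ = 1 := (hh ⟨x, hx⟩).symm.trans h1
    exact congrArg Subtype.val (hψ (h2.trans (map_one ψ).symm))
  · have h1 : (QuotientGroup.mk' δ.range) (δ x) = 1 := (QuotientGroup.eq_one_iff _).2 ⟨x, rfl⟩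
    have h2 := congrArg h h1
    rw [hδ, map_div, map_div, map_one, div_eq_one] at h2
    exact h2.trans (by rw [map_pow, map_pow]; rfl)

/-- Iterates of `x` stay among the finitely many roots of its minimal polynomial, and injectivity of
`τ` turns a repetition into a return to `x`. -/
lemma AlgEquiv.exists_iterate_eq {k L : Type*} [Field k] [Field L] [Algebra k L]
    [Algebra.IsAlgebraic k L] (τ : L ≃ₐ[k] L) (x : L) : ∃ n, 0 < n ∧ (τ^[n]) x = x := by
  have hx : IsIntegral k x := Algebra.IsIntegral.isIntegral x
  have hroot : ∀ n : ℕ, (τ^[n]) x ∈ (minpoly k x).rootSet L := fun n => by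
    induction n with
    | zero =>
      exact (Polynomial.mem_rootSet).2 ⟨minpoly.ne_zero hx, minpoly.aeval _ _⟩
    | succ n ih =>
      rw [Function.iterate_succ_apply']
      rw [Polynomial.mem_rootSet] at ih ⊢
      refine ⟨ih.1, ?_⟩
      rw [Polynomial.aeval_algEquiv, AlgHom.comp_apply, ih.2, map_zero]
  obtain ⟨i, j, hij, h⟩ := Finite.exists_ne_map_eq_of_infinite
    (fun n : ℕ => (⟨(τ^[n]) x, hroot n⟩ : (minpoly k x).rootSet L))
  have key : ∀ i j : ℕ, i < j → (τ^[i]) x = (τ^[j]) x → ∃ n, 0 < n ∧ (τ^[n]) x = x :=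
    fun i j hij h => ⟨j - i, by omega, by
      apply τ.injective.iterate i
      rw [← Function.iterate_add_apply, h]
      congr 2
      omega⟩
  have h' : (τ^[i]) x = (τ^[j]) x := congrArg Subtype.val h
  rcases lt_or_gt_of_ne hij with hlt | hlt
  · exact key i j hlt h'
  · exact key j i hlt h'.symm

lemma isIntegral_of_isOfFinOrder {R L : Type*} [CommRing R] [Field L] [Algebra R L] {x : Lˣ}
    (hx : IsOfFinOrder x) : IsIntegral R (x : L) := by
  obtain ⟨n, hn, h⟩ := isOfFinOrder_iff_pow_eq_one.1 hx
  refine IsIntegral.of_pow hn ?_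
  rw [← Units.val_pow_eq_pow_val, h, Units.val_one]
  exact isIntegral_one

/-! ### Rigidity on roots of unity. -/

section Rigidity

variable {L C : Type*} [Field L] [Field C] {χ : Lˣ →* Cˣ} {φ : L →+* L} {N a b : ℕ}

lemma ArithDyn.IsRadiciallyClosed.exists_pow_eq (hL : IsRadiciallyClosed L) (y : Lˣ) {n : ℕ}
    (hn : 0 < n) :
    ∃ z : Lˣ, z ^ n = y := by
  have hd : (Polynomial.X ^ n - Polynomial.C (y : L)).degree ≠ 0 := by
    rw [Polynomial.degree_X_pow_sub_C hn]
    exact_mod_cast hn.ne'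
  obtain ⟨z, hz⟩ := (hL y n hn).exists_eval_eq_zero hd
  have hz' : z ^ n = y := by simpa [sub_eq_zero] using hz
  have hz0 : z ≠ 0 := by
    rintro rfl
    rw [zero_pow hn.ne'] at hz'
    exact y.ne_zero hz'.symm
  exact ⟨Units.mk0 z hz0, Units.ext hz'⟩

/-- The polynomial $T^l-1$ splits and is separable, so it has a root other than 1, of exact order
`l` by primality. -/
lemma ArithDyn.IsRadiciallyClosed.exists_isPrimitiveRoot (hL : IsRadiciallyClosed L) {l : ℕ}
    (hl : l.Prime)
    (h0 : (l : L) ≠ 0) : ∃ z : Lˣ, IsPrimitiveRoot z l := by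
  have hs := hL 1 l hl.pos
  have hsep : (Polynomial.X ^ l - Polynomial.C (1 : L)).Separable :=
    Polynomial.separable_X_pow_sub_C _ h0 one_ne_zero
  have hcard : Multiset.card (Polynomial.X ^ l - Polynomial.C (1 : L)).roots = l := by
    rw [← hs.natDegree_eq_card_roots, Polynomial.natDegree_X_pow_sub_C]
  have hnodup := Polynomial.nodup_roots hsep
  obtain ⟨z, hz, hz1⟩ : ∃ z ∈ (Polynomial.X ^ l - Polynomial.C (1 : L)).roots, z ≠ 1 := by
    by_contra! h
    have : Multiset.card (Polynomial.X ^ l - Polynomial.C (1 : L)).roots ≤ 1 := by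
      classical
      have h1 := Multiset.nodup_iff_count_le_one.1 hnodup 1
      rwa [Multiset.eq_replicate_card.2 h, Multiset.count_replicate_self] at h1
    have := hl.two_le
    omega
  have hz' : z ^ l = 1 := by
    simpa [sub_eq_zero] using (Polynomial.mem_roots'.1 hz).2
  have hp : IsPrimitiveRoot z l := by
    rw [IsPrimitiveRoot.iff_def]
    refine ⟨hz', fun m hm => ?_⟩
    rw [← orderOf_dvd_iff_pow_eq_one] at hz' hm
    rcases (Nat.dvd_prime hl).1 hz' with h | h
    · exact absurd (orderOf_eq_one_iff.1 h) hz1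
    · rwa [h] at hm
  exact ⟨Units.mk0 z (hp.ne_zero hl.ne_zero), IsPrimitiveRoot.coe_units_iff.1 hp⟩

variable (hL : IsRadiciallyClosed L) (hfin : {y : Lˣ | y ∈ χ.ker ∧ IsOfFinOrder y}.Finite)
  (hN : 0 < N) (h : ∀ y, χ y ^ (N * a) = χ (Units.map φ y) ^ (N * b))

include hL hfin hN h in
/-- A character with finite kernel on roots of unity detects the action on roots of unity. -/
lemma pow_eq_map_pow_of_isOfFinOrder {y : Lˣ} (hy : IsOfFinOrder y) :
    y ^ a = (Units.map φ y) ^ b := by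
  let H : Subgroup Lˣ := χ.ker ⊓ CommGroup.torsion Lˣ
  have hH : Finite H := hfin
  obtain ⟨M, hM, hMH⟩ : ∃ M, 0 < M ∧ ∀ z ∈ H, z ^ M = 1 :=
    ⟨Nat.card H, Nat.card_pos, fun z hz => congrArg Subtype.val (pow_card_eq_one' (x := (⟨z, hz⟩ : H)))⟩
  -- Of the root extracted here, the factor `N` absorbs the `N` in `h`, and `M` kills the ambiguity
  -- by torsion in the kernel of `χ`.
  obtain ⟨z, rfl⟩ := hL.exists_pow_eq y (Nat.mul_pos hN hM)
  have hz : IsOfFinOrder z := hy.of_pow (Nat.mul_pos hN hM).ne'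
  have hmem : z ^ (N * a) / (Units.map (φ : L →* L) z) ^ (N * b) ∈ H := by
    refine ⟨?_, ?_⟩
    · change χ _ = 1
      rw [map_div, map_pow, map_pow, h, div_self']
    · exact (CommGroup.torsion Lˣ).div_mem (hz.pow : IsOfFinOrder (z ^ (N * a)))
        ((MonoidHom.isOfFinOrder _ hz).pow)
  have := hMH _ hmem
  rw [div_pow, div_eq_one, ← pow_mul, ← pow_mul] at this
  rw [map_pow, ← pow_mul, ← pow_mul]
  convert this using 2 <;> ring

-- If `l` were nonzero in `L`, an element `z` of order `l` would exist, and its image under `φ` has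
-- order `l` too. Then $z^a=\varphi(z)^b$ makes `l` divide both `a` and `b`.
include hL hfin hN h in
lemma cast_eq_zero_of_prime_dvd (hab : a.Coprime b) {l : ℕ} (hl : l.Prime) (hd : l ∣ a * b) :
    (l : L) = 0 := by
  by_contra h0
  obtain ⟨z, hz⟩ := hL.exists_isPrimitiveRoot hl h0
  have hz' : IsPrimitiveRoot (Units.map (φ : L →* L) z) l :=
    hz.map_of_injective (Units.map_injective φ.injective)
  have hfinz : IsOfFinOrder z := isOfFinOrder_iff_pow_eq_one.2 ⟨l, hl.pos, hz.pow_eq_one⟩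
  have key := pow_eq_map_pow_of_isOfFinOrder hL hfin hN h hfinz
  rcases hl.dvd_mul.1 hd with hd | hd
  · have h1 : l ∣ b := hz'.dvd_of_pow_eq_one b (by rw [← key]; exact hz.pow_eq_one_iff_dvd _ |>.2 hd)
    exact Nat.Prime.not_coprime_iff_dvd.2 ⟨l, hl, hd, h1⟩ hab
  · have h1 : l ∣ a := hz.dvd_of_pow_eq_one a (by rw [key]; exact hz'.pow_eq_one_iff_dvd _ |>.2 hd)
    exact Nat.Prime.not_coprime_iff_dvd.2 ⟨l, hl, h1, hd⟩ hab

end Rigidity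

/-- This reconciles the prime field `⊥` of `constantsCard` with the base `ZMod p` of the finite
field arguments. -/
lemma isIntegral_zmod_of_isIntegral_bot {p : ℕ} [Fact p.Prime] {k : Type*} [Field k]
    [Algebra (ZMod p) k] {x : k} (hx : IsIntegral (⊥ : Subfield k) x) : IsIntegral (ZMod p) x := by
  obtain ⟨f, hf, h0⟩ := hx
  have hlift : f.map (algebraMap (⊥ : Subfield k) k) ∈ Polynomial.lifts (algebraMap (ZMod p) k) := by
    rw [Polynomial.lifts_iff_coeff_lifts]
    intro n
    rw [Polynomial.coeff_map]
    exact (Subfield.bot_eq_of_zMod_algebra (K := k) p).le (f.coeff n).2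
  obtain ⟨g, hg, -, hgm⟩ := Polynomial.lifts_and_natDegree_eq_and_monic hlift (hf.map _)
  refine ⟨g, hgm, ?_⟩
  rw [← Polynomial.eval_map, hg, Polynomial.eval_map]
  exact h0

/-- If a power of Frobenius fixes all roots of unity of `k`, it is a power of the number of
constants of `k`. -/
lemma exists_pow_eq_constantsCard_pow {p : ℕ} [hp : Fact p.Prime] {k : Type*} [Field k] [CharP k p]
    {m : ℕ} (hm : 0 < m) (h : ∀ y : kˣ, IsOfFinOrder y → y ^ p ^ m = y) :
    ∃ j : ℕ, p ^ m = constantsCard k ^ j := by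
  let _ : Algebra (ZMod p) k := ZMod.algebra k p
  let E := algebraicClosure (⊥ : Subfield k) k
  -- Every nonzero constant lies in a finite field, hence is a root of unity.
  have hE : ∀ x : E, x ^ p ^ m = x := by
    rintro ⟨x, hx⟩
    refine Subtype.ext ?_
    change x ^ p ^ m = x
    rcases eq_or_ne x 0 with rfl | hx0
    · exact zero_pow (pow_pos hp.out.pos m).ne'
    have hx' : IsIntegral (ZMod p) x := isIntegral_zmod_of_isIntegral_bot hx
    have h1 := FiniteField.pow_pow_factorial_eq_of_natDegree_le hx' le_rfl
    set M := (minpoly (ZMod p) x).natDegree.factorial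
    have hM : 0 < M := Nat.factorial_pos _
    have h2 : 1 < p ^ M := Nat.one_lt_pow hM.ne' hp.out.one_lt
    have h3 : IsOfFinOrder (Units.mk0 x hx0) := by
      refine isOfFinOrder_iff_pow_eq_one.2 ⟨p ^ M - 1, by omega, Units.ext ?_⟩
      change x ^ (p ^ M - 1) = 1
      rw [← mul_right_inj' hx0, ← pow_succ', Nat.sub_add_cancel h2.le, h1, mul_one]
    exact congrArg Units.val (h _ h3)
  have hchar : CharP E p := (algebraMap E k).charP (algebraMap E k).injective p
  have hroots : ∀ r, 0 < r → (∀ x : E, x ^ p ^ r = x) → Finite E ∧ Nat.card E ≤ p ^ r := by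
    classical
    intro r hr hx
    have hne := FiniteField.X_pow_card_pow_sub_X_ne_zero E hr.ne' hp.out.one_lt
    have hsub : (Set.univ : Set E) ⊆
        ((Polynomial.X ^ p ^ r - Polynomial.X : Polynomial E).roots.toFinset : Set E) := fun x _ => by
      simpa [hne, sub_eq_zero] using hx x
    have hfin : Finite E := Set.finite_univ_iff.1 ((Finset.finite_toSet _).subset hsub)
    refine ⟨hfin, ?_⟩
    rw [← Set.ncard_univ]
    refine (Set.ncard_le_ncard hsub (Finset.finite_toSet _)).trans ?_
    rw [Set.ncard_coe_finset]
    refine (Multiset.toFinset_card_le _).trans ((Polynomial.card_roots' _).trans ?_)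
    rw [FiniteField.X_pow_card_pow_sub_X_natDegree_eq E hr.ne' hp.out.one_lt]
  have hfin := (hroots m hm hE).1
  have := Fintype.ofFinite E
  obtain ⟨f, hf⟩ := FiniteField.card E p
  have hpow : ∀ (j : ℕ) (x : E), x ^ (p ^ (f : ℕ)) ^ j = x := fun j x => by
    rw [← hf.2]
    exact FiniteField.pow_card_pow j x
  -- If $|E|=p^f$, a nonzero remainder of `m` would give a smaller Frobenius power fixing `E`, and
  -- $T^{p^{m \bmod f}}-T$ would have too many roots.
  have hr : m % f = 0 := by
    by_contra hr
    have h1 := (hroots (m % f) (Nat.pos_of_ne_zero hr) fun x => by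
      conv_rhs => rw [← hE x, ← Nat.div_add_mod m f, pow_add, pow_mul, pow_mul, hpow]).2
    rw [Nat.card_eq_fintype_card, hf.2] at h1
    have h2 := (Nat.pow_le_pow_iff_right hp.out.one_lt).1 h1
    exact absurd (Nat.mod_lt m f.pos) (not_lt.2 h2)
  refine ⟨m / f, ?_⟩
  change _ = Nat.card E ^ _
  rw [Nat.card_eq_fintype_card, hf.2, ← pow_mul, Nat.mul_div_cancel' (Nat.dvd_of_mod_eq_zero hr)]

/-- If a character of a radically closed field with finite kernel on roots of unity satisfies
`χ ^ (N * a) = (χ ∘ φ) ^ (N * b)`, where `φ` fixes the subfield `k`, then `a / b` is trivial or an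
integral power of the number of constants of `k`. -/
lemma exists_zpow_constantsCard_eq {L C k : Type*} [Field L] [Field C] [Field k] {χ : Lˣ →* Cˣ}
    {φ : L →+* L} {N a b : ℕ} (hL : IsRadiciallyClosed L)
    (hfin : {y : Lˣ | y ∈ χ.ker ∧ IsOfFinOrder y}.Finite) (hN : 0 < N)
    (h : ∀ y, χ y ^ (N * a) = χ (Units.map φ y) ^ (N * b)) (ha : 0 < a) (hb : 0 < b)
    (hab : a.Coprime b) (hne : ¬ (a = 1 ∧ b = 1)) (i : k →+* L) (hi : ∀ x, φ (i x) = i x) :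
    0 < ringChar k ∧ ∃ n : ℤ, (a : ℚ) / b = (constantsCard k : ℚ) ^ n := by
  have hab1 : a * b ≠ 1 := fun h1 => hne (mul_eq_one.1 h1)
  obtain ⟨p, hp, hpd⟩ := Nat.exists_prime_and_dvd hab1
  have := Fact.mk hp
  have hpL : (p : L) = 0 := cast_eq_zero_of_prime_dvd hL hfin hN h hab hp hpd
  have hcL : CharP L p := ringChar.of_eq (CharP.ringChar_of_prime_eq_zero hp hpL)
  have hck : CharP k p := i.charP i.injective p
  have huniq : ∀ {d : ℕ}, d.Prime → d ∣ a * b → d = p := fun {d} hd hdd =>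
    ((Nat.prime_dvd_prime_iff_eq hp hd).1 ((CharP.cast_eq_zero_iff L p d).1
      (cast_eq_zero_of_prime_dvd hL hfin hN h hab hd hdd))).symm
  -- Both `a` and `b` are powers of `p`; being coprime, one of them is 1, which gives the two cases
  -- below.
  have ha' := Nat.eq_prime_pow_of_unique_prime_dvd ha.ne' fun {d} hd hdd =>
    huniq hd (hdd.mul_right b)
  have hb' := Nat.eq_prime_pow_of_unique_prime_dvd hb.ne' fun {d} hd hdd =>
    huniq hd (hdd.mul_left a)
  set s := a.primeFactorsList.length
  set t := b.primeFactorsList.length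
  have hfix : ∀ y : kˣ, IsOfFinOrder y → y ^ a = y ^ b := fun y hy => by
    have h1 := pow_eq_map_pow_of_isOfFinOrder hL hfin hN h
      ((Units.map (i : k →* L)).isOfFinOrder hy)
    have h2 : Units.map (φ : L →* L) (Units.map (i : k →* L) y) = Units.map (i : k →* L) y :=
      Units.ext (hi y)
    rw [h2, ← map_pow, ← map_pow] at h1
    exact Units.map_injective i.injective h1
  refine ⟨by rw [ringChar.eq k p]; exact hp.pos, ?_⟩
  rcases Nat.eq_zero_or_pos s with hs | hs
  · have ha1 : a = 1 := by rw [ha', hs, pow_zero]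
    have ht : 0 < t := Nat.pos_of_ne_zero fun ht => hne ⟨ha1, by rw [hb', ht, pow_zero]⟩
    obtain ⟨j, hj⟩ := exists_pow_eq_constantsCard_pow (k := k) ht fun y hy => by
      rw [← hb', ← hfix y hy, ha1, pow_one]
    refine ⟨-j, ?_⟩
    rw [ha1, hb', hj]
    simp
  · have hb1 : b = 1 := by
      by_contra hb1
      obtain ⟨l, hl, hld⟩ := Nat.exists_prime_and_dvd hb1
      obtain rfl := huniq hl (hld.mul_left a)
      refine Nat.Prime.not_coprime_iff_dvd.2 ⟨l, hl, ?_, hld⟩ hab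
      rw [ha']
      exact dvd_pow_self _ hs.ne'
    obtain ⟨j, hj⟩ := exists_pow_eq_constantsCard_pow (k := k) hs fun y hy => by
      rw [← ha', hfix y hy, hb1, pow_one]
    refine ⟨j, ?_⟩
    rw [hb1, ha', hj]
    simp

/-! ### Evaluation on affine opens, and charts of the normalization. -/

/-- In an affine open, every element of a residue field is a quotient of values of functions. -/
lemma AlgebraicGeometry.IsAffineOpen.isFractionsOf_evaluation {X : Scheme.{u}} {V : X.Opens}
    (hV : IsAffineOpen V) (x : X) (hx : x ∈ V) : IsFractionsOf (X.evaluation V x hx).hom := by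
  intro z
  obtain ⟨w, rfl⟩ := X.residue_surjective x z
  let _ := (X.presheaf.algebra_section_stalk ⟨x, hx⟩)
  have := hV.isLocalization_stalk ⟨x, hx⟩
  obtain ⟨⟨b, s⟩, hbs⟩ := IsLocalization.surj (hV.primeIdealOf ⟨x, hx⟩).asIdeal.primeCompl w
  refine ⟨b, s, ?_, ?_⟩
  · have hu := IsLocalization.map_units (X.presheaf.stalk x) s
    exact (hu.map (X.residue x).hom).ne_zero
  · exact (map_mul (X.residue x).hom w _).symm.trans (congrArg (X.residue x).hom hbs)

/-- Points of an affine open are determined by the vanishing ideals of functions. -/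
lemma AlgebraicGeometry.IsAffineOpen.eq_of_evaluation_eq_zero_iff {X : Scheme.{u}} {V : X.Opens}
    (hV : IsAffineOpen V) {x y : X} (hx : x ∈ V) (hy : y ∈ V)
    (h : ∀ b, X.evaluation V x hx b = 0 ↔ X.evaluation V y hy b = 0) : x = y := by
  have mem : ∀ (z : V) (b : Γ(X, V)),
      b ∈ (hV.primeIdealOf z).asIdeal ↔ X.evaluation V z z.2 b = 0 := fun z b => by
    have h1 : hV.primeIdealOf z ∈ hV.fromSpec ⁻¹ᵁ X.basicOpen b ↔ (z : X) ∈ X.basicOpen b := by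
      rw [← hV.fromSpec_primeIdealOf z]
      rfl
    rw [hV.fromSpec_preimage_basicOpen, ← X.evaluation_ne_zero_iff_mem_basicOpen z.1 z.2] at h1
    exact not_iff_not.1 h1
  have key : hV.primeIdealOf ⟨x, hx⟩ = hV.primeIdealOf ⟨y, hy⟩ := by
    ext b
    rw [mem, mem]
    exact h b
  have := congrArg hV.fromSpec key
  rwa [hV.fromSpec_primeIdealOf, hV.fromSpec_primeIdealOf] at this

/-- Evaluations commute with residue field maps of morphisms. -/
lemma AlgebraicGeometry.Scheme.residueFieldMap_evaluation {X Y : Scheme.{u}} (f : X ⟶ Y)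
    {V : Y.Opens} {W : X.Opens} (e : W ≤ f ⁻¹ᵁ V) (x : X) (hx : x ∈ W) (b : Γ(Y, V)) :
    f.residueFieldMap x (Y.evaluation V (f x) (e hx) b) =
      X.evaluation W x hx (f.appLE V W e b) := by
  refine (Scheme.evaluation_naturality_apply f x (e hx) b).trans ?_
  have : X.evaluation (f ⁻¹ᵁ V) x (e hx) = X.presheaf.map (homOfLE e).op ≫ X.evaluation W x hx := by
    simp [Scheme.evaluation]
  rw [this]
  rfl

lemma AlgebraicGeometry.Scheme.residueFieldCongr_evaluation {X : Scheme.{u}} {x y : X} (h : x = y)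
    (V : X.Opens) (hx : x ∈ V) (hy : y ∈ V) (b : Γ(X, V)) :
    (X.residueFieldCongr h).hom (X.evaluation V x hx b) = X.evaluation V y hy b := by
  subst h
  rfl

namespace ArithDyn

section Chart

variable {X₀ : Scheme.{u}} [IsArithmetic X₀] {K : Type u} [Field K] [Algebra X₀.functionField K]
  (U : X₀.Opens)

lemma specTo_appLE [Nonempty U] (e : ⊤ ≤ specTo X₀ K ⁻¹ᵁ U) :
    (specTo X₀ K).appLE U ⊤ e ≫ (Scheme.ΓSpecIso (.of K)).hom =
      X₀.germToFunctionField U ≫ CommRingCat.ofHom (algebraMap X₀.functionField K) := by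
  have e' : ⊤ ≤ Spec.map (CommRingCat.ofHom (algebraMap X₀.functionField K)) ⁻¹ᵁ
    (X₀.fromSpecStalk (genericPoint X₀) ⁻¹ᵁ U) := e
  have h : (specTo X₀ K).appLE U ⊤ e = (X₀.fromSpecStalk (genericPoint X₀)).app U ≫
      (Spec.map (CommRingCat.ofHom (algebraMap X₀.functionField K))).appLE _ ⊤ e' :=
    Scheme.Hom.comp_appLE _ _ _ _ _
  have hU : genericPoint X₀ ∈ U :=
    (genericPoint_spec X₀).mem_open_set_iff U.isOpen |>.2 (by simpa using ‹Nonempty U›)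
  have h1 : X₀.germToFunctionField U = X₀.presheaf.germ U (genericPoint X₀) hU := rfl
  rw [h, Scheme.fromSpecStalk_app, h1]
  simp only [Category.assoc]
  congr 1
  rw [Scheme.Hom.map_appLE_assoc]
  exact (Iso.inv_comp_eq _).2 (Scheme.ΓSpecIso_naturality _)
  exact hU

variable (X₀ K) in
lemma specTo_closedPoint : specTo X₀ K (IsLocalRing.closedPoint K) = genericPoint X₀ := by
  refine Eq.trans ?_ (show X₀.fromSpecStalk (genericPoint X₀) (IsLocalRing.closedPoint _) = _ from
    X₀.fromSpecStalk_closedPoint)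
  change X₀.fromSpecStalk (genericPoint X₀) (Spec.map _ _) = _
  congr 1
  exact Subsingleton.elim (α := PrimeSpectrum X₀.functionField) _ _

lemma specTo_preimage [hU : Nonempty U] : specTo X₀ K ⁻¹ᵁ U = ⊤ := by
  apply Scheme.preimage_eq_top_of_closedPoint_mem
  have h := specTo_closedPoint X₀ K
  rw [h]
  exact (genericPoint_spec X₀).mem_open_set_iff U.isOpen |>.2 (by simpa using hU)

/-- The chart of the normalization in `K` above `U`. -/
noncomputable abbrev chart : (normalizationIn X₀ K).Opens := normalizationMap X₀ K ⁻¹ᵁ U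

lemma isAffineOpen_chart (hU : IsAffineOpen U) : IsAffineOpen (chart U (K := K)) :=
  hU.preimage _

lemma galMap_preimage_chart (σ : K ≃ₐ[X₀.functionField] K) :
    chart U ≤ galMap σ ⁻¹ᵁ chart U := by
  rw [← Scheme.Hom.comp_preimage, galMap_normalizationMap]

variable [Nonempty U]

lemma top_le_toNormalization_preimage_chart :
    (⊤ : (Spec (.of K)).Opens) ≤ (specTo X₀ K).toNormalization ⁻¹ᵁ chart U := by
  rw [← Scheme.Hom.comp_preimage, Scheme.Hom.toNormalization_fromNormalization, specTo_preimage]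

/-- The inclusion of the functions on the chart above `U` into `K`. -/
noncomputable def chartToField : Γ(normalizationIn X₀ K, chart U) →+* K :=
  ((specTo X₀ K).toNormalization.appLE (chart U) ⊤ (top_le_toNormalization_preimage_chart U) ≫
    (Scheme.ΓSpecIso (.of K)).hom).hom

lemma chartToField_app (a : Γ(X₀, U)) : chartToField U ((normalizationMap X₀ K).app U a) =
    algebraMap X₀.functionField K (X₀.germToFunctionField U a) := by
  have : (normalizationMap X₀ K).app U ≫ (specTo X₀ K).toNormalization.appLE (chart U) ⊤
      (top_le_toNormalization_preimage_chart U) ≫ (Scheme.ΓSpecIso (.of K)).hom =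
      X₀.germToFunctionField U ≫ CommRingCat.ofHom (algebraMap X₀.functionField K) := by
    rw [← specTo_appLE U (specTo_preimage U).ge, Scheme.Hom.app_eq_appLE,
      Scheme.Hom.appLE_comp_appLE_assoc]
    simp only [Scheme.Hom.toNormalization_fromNormalization]
  exact congrArg (fun f => f.hom a) this

/-- The action of the Galois group on the functions on the chart above `U`. -/
noncomputable def galChart (σ : K ≃ₐ[X₀.functionField] K) :
    Γ(normalizationIn X₀ K, chart U) →+* Γ(normalizationIn X₀ K, chart U) :=
  ((galMap σ).appLE (chart U) (chart U) (galMap_preimage_chart U σ)).hom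

/-- Since `chartToField` is injective over affine `U`, this equivariance reduces identities for
`galChart` to identities in `K`. -/
lemma chartToField_galChart (σ : K ≃ₐ[X₀.functionField] K) (b) :
    chartToField U (galChart U σ b) = σ (chartToField U b) := by
  have : (galMap σ).appLE (chart U) (chart U) (galMap_preimage_chart U σ) ≫
      (specTo X₀ K).toNormalization.appLE (chart U) ⊤ (top_le_toNormalization_preimage_chart U) ≫
        (Scheme.ΓSpecIso (.of K)).hom = (specTo X₀ K).toNormalization.appLE (chart U) ⊤
        (top_le_toNormalization_preimage_chart U) ≫ (Scheme.ΓSpecIso (.of K)).hom ≫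
        CommRingCat.ofHom (σ : K →+* K) := by
    have h : (specAut σ).appLE ⊤ ⊤ le_top ≫ (Scheme.ΓSpecIso (.of K)).hom =
        (Scheme.ΓSpecIso (.of K)).hom ≫ CommRingCat.ofHom (σ : K →+* K) := by
      exact Scheme.ΓSpecIso_naturality _
    have h1 := Scheme.Hom.appLE_comp_appLE (specTo X₀ K).toNormalization (galMap σ) (chart U)
      (chart U) ⊤ (galMap_preimage_chart U σ) (top_le_toNormalization_preimage_chart U)
    have h2 := Scheme.Hom.appLE_comp_appLE (specAut σ) (specTo X₀ K).toNormalization (chart U)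
      ⊤ ⊤ (top_le_toNormalization_preimage_chart U) le_top
    simp only [toNormalization_galMap] at h1
    rw [← h, reassoc_of% (h1.trans h2.symm)]
  exact congrArg (fun f => f.hom b) this

/-- The affine description of the normalization uses functions on `specTo X₀ K ⁻¹ᵁ U`, which is only
propositionally `⊤`. The transport to `K` is packed into `e`. -/
lemma exists_ringEquiv_chartToField : ∃ e : Γ(Spec (.of K), specTo X₀ K ⁻¹ᵁ U) ≃+* K,
    (∀ a, e ((specTo X₀ K).app U a) =
      algebraMap X₀.functionField K (X₀.germToFunctionField U a)) ∧
    ∀ b, chartToField U b = e ((specTo X₀ K).toNormalization.appLE (chart U)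
      (specTo X₀ K ⁻¹ᵁ U) (by
        rw [← Scheme.Hom.comp_preimage, Scheme.Hom.toNormalization_fromNormalization]) b) := by
  refine ⟨((Spec (.of K)).presheaf.mapIso (eqToIso (specTo_preimage U).symm).op ≪≫
    Scheme.ΓSpecIso (.of K)).commRingCatIsoToRingEquiv, fun a => ?_, fun b => ?_⟩
  · refine Eq.trans ?_ (congrArg (fun f => f.hom a) (specTo_appLE (K := K) U (specTo_preimage U).ge))
    rfl
  · have : (specTo X₀ K).toNormalization.appLE (chart U) ⊤
        (top_le_toNormalization_preimage_chart U) =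
        (specTo X₀ K).toNormalization.appLE (chart U) (specTo X₀ K ⁻¹ᵁ U) (by
        rw [← Scheme.Hom.comp_preimage, Scheme.Hom.toNormalization_fromNormalization]) ≫
        (Spec (.of K)).presheaf.map (eqToHom (specTo_preimage U).symm).op :=
      (Scheme.Hom.appLE_map _ _ _).symm
    rw [chartToField, this]
    rfl

lemma chartToField_injective (hU : IsAffineOpen U) :
    Function.Injective (chartToField U (K := K)) := by
  obtain ⟨e, he, he'⟩ := exists_ringEquiv_chartToField U (K := K)
  intro b b' h
  rw [he', he', e.injective.eq_iff, ← (specTo X₀ K).normalizationObjIso_hom_val hU] at h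
  have h1 := Subtype.val_injective h
  exact ((specTo X₀ K).normalizationObjIso hU).commRingCatIsoToRingEquiv.injective h1

lemma isIntegralElem_chartToField (hU : IsAffineOpen U) (b) :
    ((algebraMap X₀.functionField K).comp (X₀.germToFunctionField U).hom).IsIntegralElem
      (chartToField U (K := K) b) := by
  obtain ⟨e, he, he'⟩ := exists_ringEquiv_chartToField U (K := K)
  rw [he', ← (specTo X₀ K).normalizationObjIso_hom_val hU]
  have h : (algebraMap X₀.functionField K).comp (X₀.germToFunctionField U).hom =
    (e : _ →+* K).comp ((specTo X₀ K).app U).hom := RingHom.ext fun a => (he a).symm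
  rw [h]
  algebraize [((specTo X₀ K).app U).hom]
  obtain ⟨f, hf, hb⟩ := (((specTo X₀ K).normalizationObjIso hU).hom b).2
  refine ⟨f, hf, ?_⟩
  refine (Polynomial.hom_eval₂ f _ (e : Γ(Spec (.of K), specTo X₀ K ⁻¹ᵁ U) →+* K) _).symm.trans ?_
  exact (congrArg e hb).trans (map_zero e)

lemma exists_chartToField_eq (hU : IsAffineOpen U) (y : K)
    (hy : ((algebraMap X₀.functionField K).comp (X₀.germToFunctionField U).hom).IsIntegralElem y) :
    ∃ b, chartToField U b = y := by
  obtain ⟨e, he, he'⟩ := exists_ringEquiv_chartToField U (K := K)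
  have h : (algebraMap X₀.functionField K).comp (X₀.germToFunctionField U).hom =
    (e : _ →+* K).comp ((specTo X₀ K).app U).hom := RingHom.ext fun a => (he a).symm
  rw [h] at hy
  obtain ⟨f, hf, hb⟩ := hy
  obtain ⟨z, rfl⟩ := e.surjective y
  rw [← RingHom.coe_coe e, ← Polynomial.hom_eval₂, RingHom.coe_coe,
    map_eq_zero_iff e e.injective] at hb
  refine ⟨((specTo X₀ K).normalizationObjIso hU).inv ⟨z, f, hf, hb⟩, ?_⟩
  rw [he', ← (specTo X₀ K).normalizationObjIso_hom_val hU]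
  simp

/-- Being integrally closed can be tested at maximal ideals, where the localizations are the normal
stalks. -/
lemma isIntegrallyClosed_of_isAffineOpen (hU : IsAffineOpen U) : IsIntegrallyClosed Γ(X₀, U) := by
  refine IsIntegrallyClosed.of_localization_maximal fun p _ hp => ?_
  let y : PrimeSpectrum Γ(X₀, U) := ⟨p, hp.isPrime⟩
  have hy : hU.fromSpec y ∈ U := (hU.isoSpec.inv y).2
  let _ := TopCat.Presheaf.algebra_section_stalk X₀.presheaf ⟨hU.fromSpec y, hy⟩
  have : IsLocalization.AtPrime (X₀.presheaf.stalk (hU.fromSpec y)) p :=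
    hU.isLocalization_stalk' y hy
  have := IsArithmetic.normal (hU.fromSpec y)
  exact IsIntegrallyClosed.of_equiv
    (IsLocalization.algEquiv p.primeCompl (X₀.presheaf.stalk (hU.fromSpec y))
      (Localization.AtPrime p)).toRingEquiv

end Chart

end ArithDyn

namespace ArithDyn

/-! ### Residue fields of the normalization. -/

section Residue

variable {X₀ : Scheme.{u}} [IsArithmetic X₀] {K : Type u} [Field K] [Algebra X₀.functionField K]

/-- The functions on the chart above `U` form the integral closure of the functions on `U`. -/
lemma isIntegralClosure_chart (U : X₀.Opens) [Nonempty U] (hU : IsAffineOpen U)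
    [Algebra Γ(X₀, U) K] [Algebra Γ(normalizationIn X₀ K, chart U) K]
    (h : algebraMap Γ(X₀, U) K =
      (algebraMap X₀.functionField K).comp (X₀.germToFunctionField U).hom)
    (h' : algebraMap Γ(normalizationIn X₀ K, chart U) K = chartToField U) :
    IsIntegralClosure Γ(normalizationIn X₀ K, chart U) Γ(X₀, U) K where
  algebraMap_injective := h' ▸ chartToField_injective U hU
  isIntegral_iff := by
    intro y
    rw [h', _root_.IsIntegral, h]
    exact ⟨exists_chartToField_eq U hU y, by
      rintro ⟨b, rfl⟩; exact isIntegralElem_chartToField U hU b⟩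

open Polynomial in
/-- Residue fields of the normalization in a radically closed field are radically closed. -/
lemma isRadiciallyClosed_residueField (hK : IsRadiciallyClosed K) (x : normalizationIn X₀ K) :
    IsRadiciallyClosed ((normalizationIn X₀ K).residueField x) := by
  obtain ⟨U, hU, hx, -⟩ := exists_isAffineOpen_mem_and_subset
    (TopologicalSpace.Opens.mem_top (normalizationMap X₀ K x))
  have : Nonempty U := ⟨⟨_, hx⟩⟩
  let _ : Algebra Γ(X₀, U) Γ(normalizationIn X₀ K, chart U) :=
    ((normalizationMap X₀ K).app U).hom.toAlgebra
  let _ : Algebra Γ(X₀, U) K :=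
    ((algebraMap X₀.functionField K).comp (X₀.germToFunctionField U).hom).toAlgebra
  let _ : Algebra Γ(normalizationIn X₀ K, chart U) K := (chartToField U).toAlgebra
  have : IsScalarTower Γ(X₀, U) Γ(normalizationIn X₀ K, chart U) K :=
    .of_algebraMap_eq fun a => (chartToField_app U a).symm
  have := isIntegralClosure_chart (K := K) U hU rfl rfl
  set ev := ((normalizationIn X₀ K).evaluation (chart U) x hx).hom with hev
  intro z N hN
  obtain ⟨b, s, hs, hz⟩ : ∃ b s, ev s ≠ 0 ∧ z * ev s = ev b :=
    (isAffineOpen_chart U hU).isFractionsOf_evaluation x hx z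
  -- Multiplying numerator and denominator by $s^{N-1}$ makes the denominator an `N`-th power. The
  -- polynomial then has coefficients in the chart ring, and the substitution $T\mapsto
  -- \mathrm{ev}(s)T$ recovers $T^N-z$.
  have hsplit : (X ^ N - C (ev (b * s ^ (N - 1)))).Splits := by
    have h := IsIntegralClosure.splits_of_splits_map Γ(X₀, U) (K := K)
      (monic_X_pow_sub_C (b * s ^ (N - 1)) hN.ne')
      (by simpa [RingHom.algebraMap_toAlgebra] using hK (chartToField U (b * s ^ (N - 1))) N hN)
    simpa using h.map ev
  have hz' : ev (b * s ^ (N - 1)) = z * ev s ^ N := by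
    rw [map_mul, map_pow, ← hz, mul_assoc, ← pow_succ', Nat.sub_add_cancel hN]
  have h1 : X ^ N - C z = C (ev s ^ N)⁻¹ *
      (X ^ N - C (ev (b * s ^ (N - 1)))).comp (C (ev s) * X) := by
    rw [hz', sub_comp, X_pow_comp, C_comp, mul_pow, mul_sub, ← mul_assoc, ← C_pow, ← C_mul,
      ← C_mul, inv_mul_cancel₀ (pow_ne_zero _ hs), C_1, one_mul, mul_left_comm,
      inv_mul_cancel₀ (pow_ne_zero _ hs), mul_one]
  rw [h1]
  refine (Splits.C _).mul (hsplit.comp_of_natDegree_le_one ?_)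
  exact (natDegree_C_mul_le _ _).trans natDegree_X_le

/-- The endomorphism of the residue field at a fixed point induced by a Galois automorphism. -/
noncomputable def residueFieldEnd (σ : K ≃ₐ[X₀.functionField] K) {x : normalizationIn X₀ K}
    (h : galMap σ x = x) : (normalizationIn X₀ K).residueField x →+*
      (normalizationIn X₀ K).residueField x :=
  (((normalizationIn X₀ K).residueFieldCongr h.symm).hom ≫ (galMap σ).residueFieldMap x).hom

lemma residueFieldEnd_evaluation (U : X₀.Opens) [Nonempty U] (σ : K ≃ₐ[X₀.functionField] K)
    {x : normalizationIn X₀ K} (h : galMap σ x = x) (hx : x ∈ chart U (K := K)) (b) :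
    residueFieldEnd σ h ((normalizationIn X₀ K).evaluation (chart U) x hx b) =
      (normalizationIn X₀ K).evaluation (chart U) x hx (galChart U σ b) := by
  change (galMap σ).residueFieldMap x (((normalizationIn X₀ K).residueFieldCongr h.symm).hom
    ((normalizationIn X₀ K).evaluation (chart U) x hx b)) = _
  rw [Scheme.residueFieldCongr_evaluation h.symm (chart U) hx
    (galMap_preimage_chart U σ hx)]
  exact Scheme.residueFieldMap_evaluation (galMap σ) (galMap_preimage_chart U σ) x hx b

/-- Functions pulled back from `X₀` lie in the function field, which `σ` fixes; elements of the
residue field below are quotients of their values. -/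
lemma residueFieldEnd_residueFieldMap (σ : K ≃ₐ[X₀.functionField] K)
    {x : normalizationIn X₀ K} (h : galMap σ x = x)
    (z : X₀.residueField (normalizationMap X₀ K x)) :
    residueFieldEnd σ h ((normalizationMap X₀ K).residueFieldMap x z) =
      (normalizationMap X₀ K).residueFieldMap x z := by
  obtain ⟨U, hU, hx, -⟩ := exists_isAffineOpen_mem_and_subset
    (TopologicalSpace.Opens.mem_top (normalizationMap X₀ K x))
  have : Nonempty U := ⟨⟨_, hx⟩⟩
  have key : ∀ a, residueFieldEnd σ h ((normalizationMap X₀ K).residueFieldMap x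
      (X₀.evaluation U _ hx a)) =
      (normalizationMap X₀ K).residueFieldMap x (X₀.evaluation U _ hx a) := fun a => by
    have h1 : galChart U σ ((normalizationMap X₀ K).app U a) = (normalizationMap X₀ K).app U a := by
      apply chartToField_injective U hU
      rw [chartToField_galChart, chartToField_app, σ.commutes]
    have h2 := Scheme.evaluation_naturality_apply (normalizationMap X₀ K) x hx a
    have h3 := residueFieldEnd_evaluation U σ h hx ((normalizationMap X₀ K).app U a)
    rw [h1] at h3
    rw [h2]
    exact h3
  obtain ⟨b, s, hs, hz⟩ := hU.isFractionsOf_evaluation _ hx z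
  have hs' := (map_ne_zero ((normalizationMap X₀ K).residueFieldMap x).hom).2 hs
  have h2 := congrArg ((normalizationMap X₀ K).residueFieldMap x).hom hz
  rw [map_mul] at h2
  refine mul_right_cancel₀ hs' (Eq.trans ?_ h2.symm)
  have h3 := congrArg (residueFieldEnd σ h) h2
  rw [map_mul] at h3
  refine Eq.trans ?_ (h3.trans (key b))
  exact congrArg _ (key s).symm

end Residue

/-! ### Stabilizers in terms of characters. -/

section CharPoint

variable {C : Type v} [Field C]

/-- Characters at equal points live on different types; transport along `residueFieldCongr` replaces
heterogeneous equality. -/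
lemma CharPoint.ext_iff_residueFieldCongr {X : Scheme.{u}} {P Q : CharPoint X C} :
    P = Q ↔ ∃ h : Q.pt = P.pt, ∀ y, P.char (Units.map (X.residueFieldCongr h).hom.hom y) =
      Q.char y := by
  obtain ⟨x, χ, hχ⟩ := P
  obtain ⟨x', χ', hχ'⟩ := Q
  constructor
  · rintro ⟨⟩
    exact ⟨rfl, fun y => by rw [Scheme.residueFieldCongr_refl]; rfl⟩
  · rintro ⟨h, hy⟩
    dsimp only at h
    subst h
    refine CharPoint.ext rfl (heq_of_eq (MonoidHom.ext fun y => Eq.trans ?_ (hy y)))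
    rw [Scheme.residueFieldCongr_refl]
    rfl

variable {X₀ : Scheme.{u}} [IsArithmetic X₀] {K : Type u} [Field K] [Algebra X₀.functionField K]

lemma smul_map_galMap_eq_smul_iff (σ : K ≃ₐ[X₀.functionField] K) (P : DotX X₀ K C) (a b : ℕ+) :
    (a • P).map (galMap σ) = b • P ↔ ∃ h : galMap σ P.pt = P.pt,
      ∀ y, P.char (Units.map (residueFieldEnd σ h) y) ^ (a : ℕ) = P.char y ^ (b : ℕ) := by
  rw [CharPoint.ext_iff_residueFieldCongr]
  constructor
  · rintro ⟨h, hy⟩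
    refine ⟨h.symm, fun y => ?_⟩
    exact (map_pow P.char _ _).symm.trans ((hy y).trans (map_pow P.char y _))
  · rintro ⟨h, hy⟩
    refine ⟨h.symm, fun y => ?_⟩
    exact (map_pow P.char _ _).trans ((hy y).trans (map_pow P.char _ _).symm)

lemma posRat_eq_div (q : PosRat) : (q : ℚ) = ((q.num : ℕ) : ℚ) / ((q.den : ℕ) : ℚ) := by
  rw [q.num_eq, mul_div_cancel_right₀]
  exact_mod_cast q.den.pos.ne'

/-- Equality in the colimit holds only at a later stage, which costs the factor `N`, and equality
modulo the Galois group costs `σ`. -/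
lemma CheckX₀.exists_of_smul_eq {P : DotX X₀ K C} {n : ℕ+} {q : PosRat}
    (h : q • NColim.mk (DotX₀.mk P) n = NColim.mk (DotX₀.mk P) n) :
    ∃ (N : ℕ+) (σ : K ≃ₐ[X₀.functionField] K),
      ((N * q.den) • P).map (galMap σ) = (N * q.num) • P := by
  rw [NColim.smul_mk (PosRat.num_eq q).symm, NColim.mk_eq_mk] at h
  obtain ⟨k, hk⟩ := h
  rw [← mul_smul, DotX₀.smul_mk, DotX₀.smul_mk] at hk
  obtain ⟨σ, hσ⟩ := Quotient.exact hk
  refine ⟨k * n, σ.unop, ?_⟩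
  rwa [mul_assoc, mul_comm n]

lemma CheckX₀.smul_eq_of_smul_map_eq {P : DotX X₀ K C} {n : ℕ+} {q : PosRat} {a : ℕ+}
    (hq : (q : ℚ) = (a : ℕ)) (σ : K ≃ₐ[X₀.functionField] K) (h : P.map (galMap σ) = a • P) :
    q • NColim.mk (DotX₀.mk P) n = (NColim.mk (DotX₀.mk P) n : CheckX₀ X₀ K C) := by
  rw [NColim.smul_mk (a := a) (b := 1) (by simpa using hq), one_mul, DotX₀.smul_mk]
  congr 1
  exact Quotient.sound ⟨.op σ, h⟩

end CharPoint
end ArithDyn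

/-- The fraction field of a quotient of a ring of finite type is essentially of finite type. -/
lemma IsFractionsOf.essFiniteType {R B L : Type*} [CommRing R] [CommRing B] [Field L] [Algebra R B]
    [Algebra R L] [Algebra.FiniteType R B] {ev : B →+* L} (hev : IsFractionsOf ev)
    (h : ev.comp (algebraMap R B) = algebraMap R L) : Algebra.EssFiniteType R L := by
  classical
  let f : B →ₐ[R] L := { ev with commutes' := fun r => congrArg (fun g => g r) h }
  obtain ⟨s, hs⟩ := ‹Algebra.FiniteType R B›
  have hmem : ∀ b, ev b ∈ Algebra.adjoin R ((s.image f : Finset L) : Set L) := fun b => by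
    rw [Finset.coe_image, ← AlgHom.map_adjoin, hs]
    exact ⟨b, trivial, rfl⟩
  refine (Algebra.essFiniteType_iff R L).2 ⟨s.image f, fun z => ?_⟩
  obtain ⟨b, t, ht, hz⟩ := hev z
  exact ⟨ev t, hmem t, ht.isUnit, hz ▸ hmem b⟩

namespace ArithDyn

/-! ### Finiteness, surjectivity and lifting of residue automorphisms. -/

section Surjectivity

variable {X₀ : Scheme.{u}} [IsArithmetic X₀]

lemma finiteType_int_of_isAffineOpen {U : X₀.Opens} (hU : IsAffineOpen U) :
    Algebra.FiniteType ℤ Γ(X₀, U) := by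
  have := IsArithmetic.locallyOfFiniteType (X := X₀)
  have h := (specULiftZIsTerminal.from X₀).finiteType_appLE (isAffineOpen_top _) hU
    (show U ≤ _ ⁻¹ᵁ ⊤ from le_top)
  let e : ℤ ≃+* Γ(Spec (.of (ULift.{u} ℤ)), ⊤) := ULift.ringEquiv.symm.trans
    (Scheme.ΓSpecIso (.of (ULift.{u} ℤ))).commRingCatIsoToRingEquiv.symm
  have h1 := h.comp (RingHom.FiniteType.of_surjective (e : ℤ →+* _) e.surjective)
  rwa [Subsingleton.elim (RingHom.comp _ _) (algebraMap ℤ Γ(X₀, U)),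
    RingHom.finiteType_algebraMap] at h1

variable (X₀) (K : Type u) [Field K] [Algebra X₀.functionField K]

/-- The image contains the generic point, so the map is dominant; it is integral, hence closed. -/
lemma normalizationMap_surjective : Function.Surjective (normalizationMap X₀ K) := by
  have h0 : genericPoint X₀ ∈ Set.range (normalizationMap X₀ K) := by
    refine ⟨(specTo X₀ K).toNormalization (IsLocalRing.closedPoint K), ?_⟩
    refine (Scheme.Hom.comp_apply (specTo X₀ K).toNormalization (normalizationMap X₀ K) _).symm.trans
      ?_
    rw [Scheme.Hom.toNormalization_fromNormalization]
    exact specTo_closedPoint X₀ K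
  have h1 : IsDominant (normalizationMap X₀ K) := ⟨by
    rw [DenseRange, dense_iff_closure_eq, ← Set.univ_subset_iff, ← (genericPoint_spec X₀)]
    exact closure_mono (Set.singleton_subset_iff.2 h0)⟩
  exact (normalizationMap X₀ K).surjective

end Surjectivity

section Decomposition

variable {X₀ : Scheme.{u}} [IsArithmetic X₀] {K : Type u} [Field K] [Algebra X₀.functionField K]

/-- The Galois action on the functions on the chart above `U`. -/
noncomputable abbrev galChartAction (U : X₀.Opens) [Nonempty U] (hU : IsAffineOpen U) :
    MulSemiringAction Gal(K/X₀.functionField) Γ(normalizationIn X₀ K, chart U) where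
  smul σ := galChart U σ
  one_smul b := chartToField_injective U hU (chartToField_galChart U 1 b)
  mul_smul σ τ b := chartToField_injective U hU (by
    refine (chartToField_galChart U (σ * τ) b).trans ?_
    refine Eq.trans ?_ (chartToField_galChart U σ (galChart U τ b)).symm
    rw [chartToField_galChart]
    rfl)
  smul_zero σ := map_zero (galChart U σ)
  smul_add σ := map_add (galChart U σ)
  smul_one σ := map_one (galChart U σ)
  smul_mul σ := map_mul (galChart U σ)

/-- Residue field extensions of the normalization in a Galois extension are normal, and their
automorphisms are induced by Galois automorphisms. -/
lemma normal_and_exists_residueFieldEnd_eq [IsGalois X₀.functionField K]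
    (x : normalizationIn X₀ K)
    [Algebra (X₀.residueField (normalizationMap X₀ K x)) ((normalizationIn X₀ K).residueField x)]
    (halg : algebraMap _ _ = ((normalizationMap X₀ K).residueFieldMap x).hom) :
    Normal (X₀.residueField (normalizationMap X₀ K x)) ((normalizationIn X₀ K).residueField x) ∧
    ∀ τ : (normalizationIn X₀ K).residueField x ≃ₐ[X₀.residueField (normalizationMap X₀ K x)]
      (normalizationIn X₀ K).residueField x, ∃ (σ : K ≃ₐ[X₀.functionField] K) (h : galMap σ x = x),
      ∀ z, residueFieldEnd σ h z = τ z := by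
  obtain ⟨U, hU, hx, -⟩ := exists_isAffineOpen_mem_and_subset
    (TopologicalSpace.Opens.mem_top (normalizationMap X₀ K x))
  have : Nonempty U := ⟨⟨_, hx⟩⟩
  have hx' : x ∈ chart U (K := K) := hx
  let _ : Algebra Γ(X₀, U) Γ(normalizationIn X₀ K, chart U) :=
    ((normalizationMap X₀ K).app U).hom.toAlgebra
  let _ : Algebra Γ(X₀, U) K :=
    ((algebraMap X₀.functionField K).comp (X₀.germToFunctionField U).hom).toAlgebra
  let _ : Algebra Γ(normalizationIn X₀ K, chart U) K := (chartToField U).toAlgebra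
  let _ : Algebra Γ(X₀, U) (X₀.residueField (normalizationMap X₀ K x)) :=
    (X₀.evaluation U _ hx).hom.toAlgebra
  have : IsScalarTower Γ(X₀, U) Γ(normalizationIn X₀ K, chart U) K :=
    .of_algebraMap_eq fun a => (chartToField_app U a).symm
  have : IsScalarTower Γ(X₀, U) X₀.functionField K := .of_algebraMap_eq fun a => rfl
  have := isIntegralClosure_chart (K := K) U hU rfl rfl
  have := functionField_isFractionRing_of_isAffineOpen X₀ U hU
  have := isIntegrallyClosed_of_isAffineOpen U hU
  let _ := galChartAction (K := K) U hU
  set ev := ((normalizationIn X₀ K).evaluation (chart U) x hx').hom with hev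
  have hfrac : IsFractionsOf ev := (isAffineOpen_chart U hU).isFractionsOf_evaluation x hx'
  have hcomm : ∀ a, ev (algebraMap Γ(X₀, U) _ a) = algebraMap
      (X₀.residueField (normalizationMap X₀ K x)) _ (algebraMap Γ(X₀, U) _ a) := fun a => by
    rw [halg]
    exact (Scheme.evaluation_naturality_apply (normalizationMap X₀ K) x hx a).symm
  refine ⟨normal_of_isFractionsOf Γ(X₀, U) X₀.functionField K ev hcomm hfrac, fun τ => ?_⟩
  obtain ⟨σ, hσ⟩ := exists_galois_smul_eq (K₀ := X₀.functionField) (K := K) ev hcomm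
    (fun g b => chartToField_galChart U g b) τ
  -- Since `ev (σ b) = τ (ev b)`, the same functions vanish at `x` and at its image.
  have hfix : galMap σ x = x := by
    refine (isAffineOpen_chart U hU).eq_of_evaluation_eq_zero_iff
      (galMap_preimage_chart U σ hx') hx' fun b => ?_
    have h1 := Scheme.residueFieldMap_evaluation (galMap σ) (galMap_preimage_chart U σ) x hx' b
    have h2 : ev (galChart U σ b) = τ (ev b) := hσ b
    rw [← map_eq_zero ((galMap σ).residueFieldMap x).hom]
    exact (Iff.of_eq (congrArg (· = 0) (h1.trans h2))).trans (map_eq_zero τ)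
  refine ⟨σ, hfix, fun z => ?_⟩
  obtain ⟨b, s, hs, hz⟩ := hfrac z
  have key : ∀ b, residueFieldEnd σ hfix (ev b) = τ (ev b) := fun b =>
    (residueFieldEnd_evaluation U σ hfix hx' b).trans (hσ b)
  have h3 := congrArg (residueFieldEnd σ hfix) hz
  rw [map_mul, key, key, ← hz, map_mul] at h3
  exact mul_right_cancel₀ ((map_ne_zero τ).2 hs) h3

end Decomposition

end ArithDyn

namespace ArithDyn

/-! ### The two halves of the theorem. -/

section Stabilizer

variable {X₀ : Scheme.{u}} [IsArithmetic X₀] {K : Type u} [Field K] [Algebra X₀.functionField K]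
  {C : Type v} [Field C]

lemma exists_zpow_of_mem_stabilizer (hK : IsRadiciallyClosed K) (P₀ : CheckX₀ X₀ K C)
    {q : PosRat} (hq : q ∈ MulAction.stabilizer PosRat P₀) (hq1 : q ≠ 1) :
    0 < ringChar (X₀.residueField P₀.pr) ∧
      ∃ n : ℤ, (q : ℚ) = (constantsCard (X₀.residueField P₀.pr) : ℚ) ^ n := by
  obtain ⟨⟨⟨P⟩, n⟩⟩ := P₀
  obtain ⟨N, σ, h⟩ := CheckX₀.exists_of_smul_eq (P := P) (n := n) hq
  obtain ⟨hσ, hχ⟩ := (smul_map_galMap_eq_smul_iff σ P _ _).1 h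
  rw [posRat_eq_div]
  refine exists_zpow_constantsCard_eq (isRadiciallyClosed_residueField hK P.pt) P.finite_torsion
    N.pos (fun y => (hχ y).symm) q.num.pos q.den.pos ?_ ?_
    ((normalizationMap X₀ K).residueFieldMap P.pt).hom (residueFieldEnd_residueFieldMap σ hσ)
  · have h1 : q.1.num.natAbs = (q.num : ℕ) := by
      change q.1.num.natAbs = q.1.num.toNat
      have := Rat.num_pos.2 q.2
      omega
    exact h1 ▸ q.1.reduced
  · rintro ⟨h1, h2⟩
    refine hq1 (Subtype.ext ?_)
    rw [posRat_eq_div, h1, h2]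
    simp

lemma exists_stabilizer_ne_bot [IsGalois X₀.functionField K] [IsAlgClosed C] [CharZero C] (x₀ : X₀)
    (hx₀ : 0 < ringChar (X₀.residueField x₀)) :
    ∃ P₀ : CheckX₀ X₀ K C, P₀.pr = x₀ ∧ MulAction.stabilizer PosRat P₀ ≠ ⊥ := by
  obtain ⟨x, rfl⟩ := normalizationMap_surjective X₀ K x₀
  set k := X₀.residueField (normalizationMap X₀ K x)
  set L := (normalizationIn X₀ K).residueField x
  set p := ringChar k with hp
  have hprime : Fact p.Prime :=
    ⟨(CharP.char_is_prime_or_zero k p).resolve_right hx₀.ne'⟩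
  let _ : Algebra k L := ((normalizationMap X₀ K).residueFieldMap x).hom.toAlgebra
  have : CharP L p := charP_of_injective_algebraMap (algebraMap k L).injective p
  let _ := ZMod.algebra k p
  let _ := ZMod.algebra L p
  -- Finite type over `ℤ` enters here: it bounds the constants of `k`.
  have hess : Algebra.EssFiniteType (ZMod p) k := by
    obtain ⟨U, hU, hx, -⟩ := exists_isAffineOpen_mem_and_subset
      (TopologicalSpace.Opens.mem_top (normalizationMap X₀ K x))
    have := finiteType_int_of_isAffineOpen hU
    have : Algebra.EssFiniteType ℤ k :=
      (hU.isFractionsOf_evaluation _ hx).essFiniteType (RingHom.ext_int _ _)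
    have : IsScalarTower ℤ (ZMod p) k := .of_algebraMap_eq' (RingHom.ext_int _ _)
    exact .of_comp ℤ _ _
  obtain ⟨M, hM0, hM⟩ := exists_pow_eq_of_essFiniteType p k
  obtain ⟨hnormal, hgal⟩ := normal_and_exists_residueFieldEnd_eq x rfl
  obtain ⟨τ, hτ⟩ := exists_algEquiv_eq_pow (L := L) hM
  obtain ⟨σ, hσ, hστ⟩ := hgal τ
  obtain ⟨ψ, hψ⟩ := exists_torsion_embedding p L C
  obtain ⟨χ, hχ, hχτ⟩ := exists_char_of_pow_action (Units.map (τ : L →* L)) (q := p ^ M)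
    (hprime.out.two_le.trans (Nat.le_self_pow hM0.ne' p))
    (fun y => by
      obtain ⟨n, hn, h⟩ := τ.exists_iterate_eq (y : L)
      refine ⟨n, hn, Units.ext ?_⟩
      refine Eq.trans ?_ h
      exact Function.Semiconj.iterate_right (f := fun u : Lˣ => (u : L)) (ga := Units.map (τ : L →* L))
        (gb := τ) (fun u => rfl) n y)
    (fun y hy => Units.ext (hτ y (isIntegral_of_isOfFinOrder hy))) ψ hψ
  -- Injectivity of `χ` on roots of unity makes the torsion of its kernel trivial.
  let P : DotX X₀ K C := ⟨x, χ, (Set.finite_singleton 1).subset fun y hy => hχ y hy.2 hy.1⟩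
  let a : ℕ+ := ⟨p ^ M, pow_pos hprime.out.pos M⟩
  let q : PosRat := ⟨(p : ℚ) ^ M, pow_pos (by exact_mod_cast hprime.out.pos) M⟩
  refine ⟨NColim.mk (DotX₀.mk P) 1, rfl, fun hbot => ?_⟩
  have hmem : q ∈ MulAction.stabilizer PosRat (NColim.mk (DotX₀.mk P) 1 : CheckX₀ X₀ K C) := by
    refine CheckX₀.smul_eq_of_smul_map_eq (a := a) (by simp [q, a]) σ ?_
    have h : (((1 : ℕ+) • P).map (galMap σ)) = a • P := by
      refine (smul_map_galMap_eq_smul_iff σ P _ _).2 ⟨hσ, fun y => ?_⟩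
      rw [PNat.one_coe, pow_one]
      refine Eq.trans ?_ (hχτ y)
      exact congrArg χ (Units.ext (hστ y))
    rwa [one_smul] at h
  rw [hbot, Subgroup.mem_bot] at hmem
  have h1 : (p : ℚ) ^ M = 1 := congrArg Subtype.val hmem
  have h2 : p ^ M = 1 := by exact_mod_cast h1
  exact hprime.out.one_lt.ne' ((Nat.pow_eq_one.1 h2).resolve_right hM0.ne')

end Stabilizer

end ArithDyn

theorem mainTheorem6 (X₀ : Scheme.{u}) [IsArithmetic X₀]
    (K : Type u) [Field K] [Algebra X₀.functionField K] [IsGalois X₀.functionField K]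
    (hK : IsRadiciallyClosed K) (C : Type v) [Field C] [IsAlgClosed C] [CharZero C] :
    (∀ P₀ : CheckX₀ X₀ K C, MulAction.stabilizer PosRat P₀ ≠ ⊥ →
      0 < ringChar (X₀.residueField P₀.pr) ∧
      ∀ q ∈ MulAction.stabilizer PosRat P₀,
        ∃ n : ℤ, (q : ℚ) = (constantsCard (X₀.residueField P₀.pr) : ℚ) ^ n) ∧
    (∀ x₀ : X₀, 0 < ringChar (X₀.residueField x₀) →
      ∃ P₀ : CheckX₀ X₀ K C, P₀.pr = x₀ ∧ MulAction.stabilizer PosRat P₀ ≠ ⊥) := by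
  refine ⟨fun P₀ h => ?_, exists_stabilizer_ne_bot⟩
  obtain ⟨⟨q, hq⟩, hq1⟩ := Subgroup.ne_bot_iff_exists_ne_one.1 h
  have hq1 : q ≠ 1 := fun h1 => hq1 (Subtype.ext h1)
  refine ⟨(exists_zpow_of_mem_stabilizer hK P₀ hq hq1).1, fun r hr => ?_⟩
  by_cases hr1 : r = 1
  · exact ⟨0, by rw [hr1]; simp⟩
  · exact (exists_zpow_of_mem_stabilizer hK P₀ hr hr1).2
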